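/- Identify the circle $S^1$ with $\mathbb{R}/2\pi\mathbb{Z}$ and functions on it with $2\pi$-periodic functions on $\mathbb{R}$. Let $\theta_1,\theta_2:S^1\to\mathbb{R}$ be smooth, $A=i\,\mathrm{diag}(\theta_1,\theta_2)$, and let $\mathcal{D}=-i\left(\frac{d}{dt}+A\right)$ be the covariant Dirac operator on $L^2(S^1,\mathbb{C}^2)$. Let $\mathcal{A}=C^\infty(S^1,M_2(\mathbb{C}))$ act by multiplication. The pure states of $\mathcal{A}$ are $\zeta_y(a)=\langle\zeta,a(y)\zeta\rangle$, $y\in S^1$, $\zeta\in\mathbb{C}P^1$ (represented by a unit vector); they form a bundle $P$ over $S^1$. The spectral distance is $$d(p,q)=\sup\{|p(a)-q(a)|\;:\;a\in\mathcal{A},\ \|[\mathcal{D},a]\|\le 1\}\in[0,+\infty].$$ The horizontal distance $d_H(p,q)$ is the infimum of the lengths of the base projections of the curves in $P$ from $p$ to $q$ that are horizontal for the connection $A$ ($+\infty$ if there are none). Put $\mathrm{Con}(p)=\{q\in P: d(p,q)<\infty\}$ and $\mathrm{Acc}(p)=\{q\in P: d_H(p,q)<\infty\}$. Let $\Theta_j(\tau)=\int_0^\tau\theta_j(t)\,dt$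 and $\omega=\frac{\Theta_1(2\pi)-\Theta_2(2\pi)}{2\pi}$. Let $x$ be the point of coordinate $0$ and let $\xi\in\mathbb{C}P^1$ be represented by the unit vector $(V_1,V_2)$. Put $V_j(\tau)=V_je^{-i\Theta_j(\tau)}$, $z_\xi=|V_1|^2-|V_2|^2$, $R=\sqrt{1-z_\xi^2}$, and let $\mathbb{T}_\xi\subset P$ be the set of the states given, over arbitrary points of $S^1$, by the vectors $(V_1,e^{i\varphi}V_2)$, $\varphi\in\mathbb{R}$. For $k\in\mathbb{Z}$, $0\le\tau_0\le2\pi$ and $\varphi\in\mathbb{R}$, let $\zeta_y\in\mathbb{T}_\xi$ be the state given, over the point $y$ of coordinate $\tau=2k\pi+\tau_0$ modulo $2\pi$, by the vector $(V_1(\tau),e^{i\varphi}V_2(\tau))$. (i) If the holonomy is trivial, that is $\Theta_1(2\pi)=\Theta_2(2\pi)$ modulo $2\pi$, then $\mathrm{Con}(\xi_x)=\mathrm{Acc}(\xi_x)$, and for all $(k,\tau_0,\varphi)$ $$d(\xi_x,\zeta_y)=\begin{cases}\min(\tau_0,2\pi-\tau_0)&\text{if }\varphi\in2\pi\mathbb{Z}\text{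 or }R=0,\\+\infty&\text{if }\varphi\notin2\pi\mathbb{Z}\text{ and }R\neq0.\end{cases}$$ (ii) Otherwise $\mathrm{Con}(\xi_x)=\mathbb{T}_\xi$, and for all $(k,\tau_0,\varphi)$ $$d(\xi_x,\zeta_y)=\max_{(T,\Delta)\in\mathcal{T}_\pm}H_\xi(T,\Delta),$$ where the maximum is attained, the sign is the one of $z_\xi$ (either sign if $z_\xi=0$), $$\mathcal{T}_\pm=\{(T,\Delta)\in\mathbb{R}^2:\ T\ge0,\ \pm\Delta\ge0,\ T\pm\Delta\le\min(\tau_0,2\pi-\tau_0)\},$$ $$H_\xi(T,\Delta)=T+z_\xi\Delta+RW_{k+1}\sqrt{(\tau_0-T)^2-\Delta^2}+RW_k\sqrt{(2\pi-\tau_0-T)^2-\Delta^2},$$ $$W_k=\frac{|\sin(k\omega\pi+\frac{\varphi}{2})|}{|\sin\omega\pi|}.$$ -/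

import Mathlib

open scoped ContDiff Matrix ENNReal

noncomputable section

namespace SpectralCircle

/-- The involutive algebra of smooth functions from the circle to the complex `n × n` matrices.
The circle is `ℝ / 2πℤ`, so its elements are the smooth `2π`-periodic matrix functions on `ℝ`,
with pointwise operations. -/
def loopAlgebra (n : ℕ) : StarSubalgebra ℂ (ℝ → Matrix (Fin n) (Fin n) ℂ) where
  carrier := {a | (∀ i j, ContDiff ℝ ∞ fun t => a t i j) ∧ Function.Periodic a (2 * Real.pi)}
  mul_mem' := by
    rintro a b ⟨ha, ha'⟩ ⟨hb, hb'⟩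
    refine ⟨fun i j => ?_, ha'.mul hb'⟩
    simp only [Pi.mul_apply, Matrix.mul_apply]
    exact ContDiff.sum fun l _ => (ha i l).mul (hb l j)
  add_mem' := by
    rintro a b ⟨ha, ha'⟩ ⟨hb, hb'⟩
    exact ⟨fun i j => (ha i j).add (hb i j), ha'.add hb'⟩
  algebraMap_mem' := by
    intro r
    refine ⟨fun i j => ?_, fun t => rfl⟩
    exact contDiff_const (c := (algebraMap ℂ (Matrix (Fin n) (Fin n) ℂ) r) i j)
  star_mem' := by
    rintro a ⟨ha, ha'⟩
    refine ⟨fun i j => ?_, fun t => ?_⟩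
    · exact Complex.conjCLE.contDiff.comp (ha j i)
    · change star (a _) = star (a _)
      rw [ha' t]

/-- The smooth spinors on the circle with values in `ℂⁿ`: a dense common domain for the Dirac
operator and its commutators in the Hilbert space of square integrable `ℂⁿ`-valued spinors. -/
def spinors (n : ℕ) : Submodule ℂ (ℝ → Fin n → ℂ) where
  carrier := {ψ | ContDiff ℝ ∞ ψ ∧ Function.Periodic ψ (2 * Real.pi)}
  add_mem' := by
    rintro a b ⟨ha, ha'⟩ ⟨hb, hb'⟩
    exact ⟨ha.add hb, ha'.add hb'⟩
  zero_mem' := ⟨contDiff_const, fun _ => rfl⟩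
  smul_mem' := by
    rintro c a ⟨ha, ha'⟩
    refine ⟨contDiff_const.smul ha, fun t => ?_⟩
    simp only [Pi.smul_apply, ha' t]

/-- The norm of the Hilbert space of square integrable `ℂⁿ`-valued spinors on the circle. -/
def l2Norm {n : ℕ} (ψ : ℝ → Fin n → ℂ) : ℝ :=
  √(∫ t in (0 : ℝ)..(2 * Real.pi), ∑ j, ‖ψ t j‖ ^ 2)

/-- The skew-adjoint gauge field `A = i diag(θ₁, …, θₙ)`. -/
def gaugeField {n : ℕ} (θ : Fin n → ℝ → ℝ) (t : ℝ) : Matrix (Fin n) (Fin n) ℂ :=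
  Matrix.diagonal fun j => Complex.I * (θ j t : ℂ)

/-- The covariant Dirac operator `-i (d/dt + A)`. -/
def dirac {n : ℕ} (θ : Fin n → ℝ → ℝ) (ψ : ℝ → Fin n → ℂ) : ℝ → Fin n → ℂ :=
  fun t => (-Complex.I) • (deriv ψ t + gaugeField θ t *ᵥ ψ t)

/-- The commutator of the covariant Dirac operator with the operator of multiplication
by the matrix function `a`, applied to the spinor `ψ`. -/
def diracCommutator {n : ℕ} (θ : Fin n → ℝ → ℝ) (a : ℝ → Matrix (Fin n) (Fin n) ℂ)
    (ψ : ℝ → Fin n → ℂ) : ℝ → Fin n → ℂ :=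
  dirac θ (fun t => a t *ᵥ ψ t) - fun t => a t *ᵥ dirac θ ψ t

/-- The operator norm of the commutator of the covariant Dirac operator with `a`. -/
def commutatorNorm {n : ℕ} (θ : Fin n → ℝ → ℝ) (a : loopAlgebra n) : ℝ≥0∞ :=
  ⨆ ψ : spinors n, ⨆ _ : l2Norm (ψ : ℝ → Fin n → ℂ) ≤ 1,
    ENNReal.ofReal (l2Norm (diracCommutator θ a ψ))

/-- The spectral distance between two linear functionals on the algebra. -/
def spectralDist {n : ℕ} (θ : Fin n → ℝ → ℝ) (p q : loopAlgebra n →ₗ[ℂ] ℂ) : ℝ≥0∞ :=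
  ⨆ a : loopAlgebra n, ⨆ _ : commutatorNorm θ a ≤ 1, ENNReal.ofReal ‖p a - q a‖

/-- The functional `a ↦ ⟨V, a(t) V⟩`. It depends on `t` modulo `2π` and on `V` up to a phase. -/
def vectorState {n : ℕ} (t : ℝ) (V : Fin n → ℂ) : loopAlgebra n →ₗ[ℂ] ℂ where
  toFun a := star V ⬝ᵥ ((a : ℝ → Matrix (Fin n) (Fin n) ℂ) t *ᵥ V)
  map_add' a b := by
    simp [Matrix.add_mulVec]
  map_smul' c a := by
    simp [Matrix.smul_mulVec]

/-- The bundle `P` of pure states over the circle: pairs of a point of the circle and a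
point of `ℂPⁿ⁻¹` (represented by a unit vector), seen as functionals on the algebra. -/
def pureStates (n : ℕ) : Set (loopAlgebra n →ₗ[ℂ] ℂ) :=
  {p | ∃ (t : ℝ) (V : Fin n → ℂ), star V ⬝ᵥ V = 1 ∧ p = vectorState t V}

/-- The pair `(γ, V)` is a lift to `ℝ × ℂⁿ` of a horizontal curve in the bundle of pure states:
`V` is transported parallelly, `V' = -γ' A(γ) V`, along the base curve `γ`. -/
def IsHorizontal {n : ℕ} (θ : Fin n → ℝ → ℝ) (γ : ℝ → ℝ) (V : ℝ → Fin n → ℂ) : Prop :=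
  ContDiff ℝ 1 γ ∧
    ∀ t, HasDerivAt V (-(((deriv γ t : ℝ) : ℂ) • (gaugeField θ (γ t) *ᵥ V t))) t

/-- The horizontal (Carnot-Carathéodory) distance: the infimum of the lengths of the base
projections of horizontal curves `[0,1] → P` from `p` to `q`. -/
def horizontalDist {n : ℕ} (θ : Fin n → ℝ → ℝ) (p q : loopAlgebra n →ₗ[ℂ] ℂ) : ℝ≥0∞ :=
  ⨅ (γ : ℝ → ℝ) (V : ℝ → Fin n → ℂ) (_ : IsHorizontal θ γ V)
    (_ : p = vectorState (γ 0) (V 0)) (_ : q = vectorState (γ 1) (V 1)),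
    ENNReal.ofReal (∫ t in (0 : ℝ)..1, |deriv γ t|)

/-- The pure states at finite spectral distance from `p`. -/
def Con {n : ℕ} (θ : Fin n → ℝ → ℝ) (p : loopAlgebra n →ₗ[ℂ] ℂ) :
    Set (loopAlgebra n →ₗ[ℂ] ℂ) :=
  {q ∈ pureStates n | spectralDist θ p q < ⊤}

/-- The pure states at finite horizontal distance from `p`. -/
def Acc {n : ℕ} (θ : Fin n → ℝ → ℝ) (p : loopAlgebra n →ₗ[ℂ] ℂ) :
    Set (loopAlgebra n →ₗ[ℂ] ℂ) :=
  {q ∈ pureStates n | horizontalDist θ p q < ⊤}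

/-- `Θ_j(τ) = ∫₀^τ θ_j`. -/
def Theta {n : ℕ} (θ : Fin n → ℝ → ℝ) (j : Fin n) (τ : ℝ) : ℝ :=
  ∫ t in (0 : ℝ)..τ, θ j t

/-- Two directions are far from each other if the corresponding components of the holonomy
are equal, that is `Θ_i(2π) = Θ_j(2π)` modulo `2π`. -/
def Far {n : ℕ} (θ : Fin n → ℝ → ℝ) (i j : Fin n) : Prop :=
  ∃ m : ℤ, Theta θ i (2 * Real.pi) = Theta θ j (2 * Real.pi) + 2 * Real.pi * m

/-- The vector `V(τ)` with components `V_j e^{-iΘ_j(τ)}`. -/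
def liftVec {n : ℕ} (θ : Fin n → ℝ → ℝ) (V : Fin n → ℂ) (τ : ℝ) : Fin n → ℂ :=
  fun j => V j * Complex.exp (-(Complex.I * (Theta θ j τ : ℂ)))

/-- The vector `(U₁, e^{iφ} U₂)`. -/
def rotate (φ : ℝ) (U : Fin 2 → ℂ) : Fin 2 → ℂ :=
  ![U 0, Complex.exp (Complex.I * (φ : ℂ)) * U 1]

/-- The torus of all pure states, on all fibers, given by the vectors `(V₁, e^{iφ} V₂)`. -/
def torus (V : Fin 2 → ℂ) : Set (loopAlgebra 2 →ₗ[ℂ] ℂ) :=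
  {p | ∃ t φ : ℝ, p = vectorState t (rotate φ V)}

/-- The state of the torus with parameters `(k, τ₀, φ)`: with `τ = 2kπ + τ₀`, it is given by
the vector `(V₁(τ), e^{iφ} V₂(τ))` over the point of coordinate `τ`. -/
def torusState (θ : Fin 2 → ℝ → ℝ) (V : Fin 2 → ℂ) (k : ℤ) (τ₀ φ : ℝ) :
    loopAlgebra 2 →ₗ[ℂ] ℂ :=
  vectorState (2 * k * Real.pi + τ₀) (rotate φ (liftVec θ V (2 * k * Real.pi + τ₀)))

/-- `z_ξ = |V₁|² - |V₂|²`. -/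
def altitude (V : Fin 2 → ℂ) : ℝ := ‖V 0‖ ^ 2 - ‖V 1‖ ^ 2

/-- `R = √(1 - z_ξ²)`. -/
def radius (V : Fin 2 → ℂ) : ℝ := √(1 - altitude V ^ 2)

/-- `ω = (Θ₁(2π) - Θ₂(2π)) / 2π`. -/
def omega (θ : Fin 2 → ℝ → ℝ) : ℝ :=
  (Theta θ 0 (2 * Real.pi) - Theta θ 1 (2 * Real.pi)) / (2 * Real.pi)

/-- `W_k = |sin(kωπ + φ/2)| / |sin ωπ|`. -/
def W (θ : Fin 2 → ℝ → ℝ) (φ : ℝ) (k : ℤ) : ℝ :=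
  |Real.sin (k * omega θ * Real.pi + φ / 2)| / |Real.sin (omega θ * Real.pi)|

/-- The function `H_ξ(T, Δ)`, of the pair `x = (T, Δ)`. -/
def H (θ : Fin 2 → ℝ → ℝ) (V : Fin 2 → ℂ) (k : ℤ) (τ₀ φ : ℝ) (x : ℝ × ℝ) : ℝ :=
  x.1 + altitude V * x.2 + radius V * W θ φ (k + 1) * √((τ₀ - x.1) ^ 2 - x.2 ^ 2)
    + radius V * W θ φ k * √((2 * Real.pi - τ₀ - x.1) ^ 2 - x.2 ^ 2)

/-- The triangle of the pairs `(T, Δ)` with `0 ≤ T`, `0 ≤ sΔ` and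
`T + sΔ ≤ min(τ₀, 2π - τ₀)`, where `s = ±1`. -/
def triangle (s τ₀ : ℝ) : Set (ℝ × ℝ) :=
  {x | 0 ≤ x.1 ∧ 0 ≤ s * x.2 ∧ x.1 + s * x.2 ≤ min τ₀ (2 * Real.pi - τ₀)}

end SpectralCircle

end

/-!
Transporting an observable back along the connection turns the covariant derivative into an
ordinary one, so that `‖[𝒟, a]‖ ≤ 1` says that the transported observable `b` is `1`-Lipschitz,
while the periodicity of `a` becomes the quasi-periodicity `b (t + 2π) = U b(t) U⁻¹` with `U` the
holonomy. One may take `b` Hermitian and, by convolution, merely Lipschitz. The distance between a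
state over `0` and a state over `τ ∈ [0, 2π]` thus only depends on the pair
`(B₀, B₁) = (b 0, b τ)`, and every pair of Hermitian matrices with
`‖B₁ - B₀‖ ≤ τ` and `‖U B₀ U⁻¹ - B₁‖ ≤ 2π - τ` occurs.

If the phases `i` and `j` of the holonomy agree, then `B₁ = B₀` may have an arbitrarily large entry
`(i, j)`, so a finite distance forces the corresponding entries of the density matrices to agree.

For two distinct phases, let `β` be the upper right entry of a matrix and `η ≠ 1` the factor by
which `U` multiplies it. Then `e^{iψ} β₁ - β₀` is a combination, with coefficients of moduli
`W_{k+1}` and `W_k`, of `β₁ - β₀` and `η β₀ - β₁`. The Hermitian matrix with diagonal `T ± D` and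
upper right entry `g` has norm `|T| + √(D² + |g|²)`, so the moduli of these two entries are at most
`√((τ - T)² - Δ²)` and `√((2π - τ - T)² - Δ²)` when `B₁ - B₀` has diagonal `T ± Δ`.
-/

noncomputable section

namespace SpectralCircle

open MeasureTheory
open scoped Matrix.Norms.L2Operator NNReal

section MatrixCalculus

theorem hasDerivAt_matrix {m n : Type*} [Finite n] {b : ℝ → Matrix m n ℂ} {b' : Matrix m n ℂ}
    {t : ℝ} : HasDerivAt b b' t ↔ ∀ i j, HasDerivAt (fun s => b s i j) (b' i j) t := by
  cases nonempty_fintype n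
  exact hasDerivAt_pi.trans (forall_congr' fun _ => hasDerivAt_pi)

theorem hasDerivAt_mulVec {m n : Type*} [Fintype n] {b : ℝ → Matrix m n ℂ} {b' : Matrix m n ℂ}
    {v : ℝ → n → ℂ} {v' : n → ℂ} {t : ℝ} (hb : HasDerivAt b b' t) (hv : HasDerivAt v v' t) :
    HasDerivAt (fun s => b s *ᵥ v s) (b' *ᵥ v t + b t *ᵥ v') t := by
  refine hasDerivAt_pi.2 fun i => ?_
  simp only [Matrix.mulVec, dotProduct, Pi.add_apply, ← Finset.sum_add_distrib]
  exact HasDerivAt.fun_sum fun j _ => (hasDerivAt_matrix.1 hb i j).mul (hasDerivAt_pi.1 hv j)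

variable {m n : Type*} [Fintype m] [Fintype n] [DecidableEq n]

theorem norm_toLp_mulVec_le (M : Matrix m n ℂ) (v : n → ℂ) :
    ‖WithLp.toLp 2 (M *ᵥ v)‖ ≤ ‖M‖ * ‖WithLp.toLp 2 v‖ :=
  M.l2_opNorm_mulVec (WithLp.toLp 2 v)

theorem opNorm_le_of_forall_norm_mulVec_le {M : Matrix m n ℂ} {c : ℝ} (hc : 0 ≤ c)
    (h : ∀ v : n → ℂ, ‖WithLp.toLp 2 (M *ᵥ v)‖ ≤ c * ‖WithLp.toLp 2 v‖) : ‖M‖ ≤ c := by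
  rw [Matrix.l2_opNorm_def]
  exact ContinuousLinearMap.opNorm_le_bound _ hc fun v => h v.ofLp

/-- The identification of the matrices, with the operator norm, with the functions of two indices,
with the supremum norm. It reduces calculus in the operator norm to calculus on the entries. -/
def entriesCLE : Matrix m n ℂ ≃L[ℝ] (m → n → ℂ) :=
  (Matrix.ofLinearEquiv ℝ).symm.toContinuousLinearEquiv

theorem contDiff_matrix {k : WithTop ℕ∞} {b : ℝ → Matrix m n ℂ} :
    ContDiff ℝ k b ↔ ∀ i j, ContDiff ℝ k fun t => b t i j := by
  rw [← entriesCLE.comp_contDiff_iff]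
  simp only [contDiff_pi]
  rfl

end MatrixCalculus

section Commutator

variable {n : ℕ} {θ : Fin n → ℝ → ℝ} {a : loopAlgebra n} {C : ℝ≥0}

theorem contDiff_coe_loopAlgebra (a : loopAlgebra n) : ContDiff ℝ ∞ a.1 :=
  contDiff_matrix.2 a.2.1

theorem hasDerivAt_coe_loopAlgebra (a : loopAlgebra n) (t : ℝ) :
    HasDerivAt a.1 (deriv a.1 t) t :=
  ((contDiff_coe_loopAlgebra a).differentiable (by simp)).differentiableAt.hasDerivAt

/-- The covariant derivative `a' + [A, a]`. Up to the factor `-i`, the commutator of the Dirac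
operator with `a` is the multiplication by this matrix function. -/
def covDeriv (θ : Fin n → ℝ → ℝ) (a : ℝ → Matrix (Fin n) (Fin n) ℂ) (t : ℝ) :
    Matrix (Fin n) (Fin n) ℂ :=
  deriv a t + ⁅gaugeField θ t, a t⁆

theorem continuous_covDeriv (hθ : ∀ j, Continuous (θ j)) (a : loopAlgebra n) :
    Continuous (covDeriv θ a) := by
  have ha := contDiff_coe_loopAlgebra a
  have hA : Continuous (gaugeField θ) :=
    Continuous.matrix_diagonal <| continuous_pi fun j => by have := hθ j; fun_prop
  exact (ha.continuous_deriv (by simp)).add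
    ((hA.mul ha.continuous).sub (ha.continuous.mul hA))

theorem covDeriv_periodic (hper : ∀ j, Function.Periodic (θ j) (2 * Real.pi))
    (a : loopAlgebra n) : Function.Periodic (covDeriv θ a) (2 * Real.pi) := fun t => by
  have hderiv : deriv a.1 (t + 2 * Real.pi) = deriv a.1 t := by
    rw [← deriv_comp_add_const]
    congr 1
    exact funext a.2.2
  have hA : gaugeField θ (t + 2 * Real.pi) = gaugeField θ t := by
    simp only [gaugeField, hper _ t]
  rw [covDeriv, covDeriv, hderiv, hA, a.2.2 t]

theorem diracCommutator_eq (θ : Fin n → ℝ → ℝ) (a : loopAlgebra n) {ψ : ℝ → Fin n → ℂ}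
    (hψ : Differentiable ℝ ψ) (t : ℝ) :
    diracCommutator θ a ψ t = (-Complex.I) • (covDeriv θ a t *ᵥ ψ t) := by
  have h := hasDerivAt_mulVec (hasDerivAt_coe_loopAlgebra a t) (hψ t).hasDerivAt
  simp only [diracCommutator, dirac, Pi.sub_apply, h.deriv, Matrix.mulVec_smul, covDeriv,
    Ring.lie_def, Matrix.add_mulVec, Matrix.sub_mulVec, Matrix.mulVec_add, Matrix.mulVec_mulVec]
  module

theorem diracCommutator_smul (θ : Fin n → ℝ → ℝ) (a : loopAlgebra n) (c : ℂ)
    {ψ : ℝ → Fin n → ℂ} (hψ : Differentiable ℝ ψ) :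
    diracCommutator θ a (c • ψ) = c • diracCommutator θ a ψ := by
  funext t
  rw [diracCommutator_eq θ a (hψ.const_smul c), Pi.smul_apply, Pi.smul_apply,
    diracCommutator_eq θ a hψ, Matrix.mulVec_smul, smul_comm]

theorem norm_toLp_diracCommutator (θ : Fin n → ℝ → ℝ) (a : loopAlgebra n) (ψ : spinors n)
    (t : ℝ) : ‖WithLp.toLp 2 (diracCommutator θ a ψ t)‖ =
      ‖WithLp.toLp 2 (covDeriv θ a t *ᵥ ψ.1 t)‖ := by
  rw [diracCommutator_eq θ a (ψ.2.1.differentiable (by simp)), WithLp.toLp_smul, norm_smul]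
  simp

theorem l2Norm_sq (ψ : ℝ → Fin n → ℂ) :
    l2Norm ψ ^ 2 = ∫ t in (0 : ℝ)..(2 * Real.pi), ‖WithLp.toLp 2 (ψ t)‖ ^ 2 := by
  simp only [EuclideanSpace.norm_sq_eq]
  exact Real.sq_sqrt <| intervalIntegral.integral_nonneg (by positivity) fun t _ => by positivity

theorem l2Norm_nonneg (ψ : ℝ → Fin n → ℂ) : 0 ≤ l2Norm ψ :=
  Real.sqrt_nonneg _

theorem l2Norm_smul (c : ℂ) (ψ : ℝ → Fin n → ℂ) : l2Norm (c • ψ) = ‖c‖ * l2Norm ψ := by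
  rw [← sq_eq_sq₀ (l2Norm_nonneg _) (mul_nonneg (norm_nonneg c) (l2Norm_nonneg _)), mul_pow,
    l2Norm_sq, l2Norm_sq, ← intervalIntegral.integral_const_mul]
  simp only [Pi.smul_apply, WithLp.toLp_smul, norm_smul, mul_pow]

theorem l2Norm_diracCommutator_le (h : commutatorNorm θ a ≤ C) (ψ : spinors n) :
    l2Norm (diracCommutator θ a ψ) ≤ C * l2Norm ψ.1 := by
  -- Dividing by `r > ‖ψ‖` instead of `‖ψ‖` covers the case `‖ψ‖ = 0`.
  refine le_mul_of_forall_lt₀ fun C' hC' r hr => ?_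
  have hr0 : 0 < r := (l2Norm_nonneg _).trans_lt hr
  have hscale (φ : ℝ → Fin n → ℂ) : l2Norm (((r⁻¹ : ℝ) : ℂ) • φ) = r⁻¹ * l2Norm φ := by
    rw [l2Norm_smul, Complex.norm_real, Real.norm_of_nonneg (inv_nonneg.2 hr0.le)]
  have hunit : l2Norm (((r⁻¹ : ℝ) : ℂ) • ψ : spinors n).1 ≤ 1 := by
    rw [Submodule.coe_smul, hscale]
    exact inv_mul_le_one_of_le₀ hr.le hr0.le
  have hle := (le_iSup₂ (f := fun (ψ : spinors n) (_ : l2Norm ψ.1 ≤ 1) =>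
    ENNReal.ofReal (l2Norm (diracCommutator θ a ψ.1))) _ hunit).trans h
  rw [Submodule.coe_smul, diracCommutator_smul θ a _ (ψ.2.1.differentiable (by simp)), hscale,
    ← ENNReal.ofReal_coe_nnreal, ENNReal.ofReal_le_ofReal_iff C.coe_nonneg,
    inv_mul_le_iff₀ hr0] at hle
  calc l2Norm (diracCommutator θ a ψ) ≤ r * C := hle
    _ ≤ C' * r := by rw [mul_comm]; gcongr

theorem commutatorNorm_le_of_norm_covDeriv_le (hθ : ∀ j, Continuous (θ j))
    (h : ∀ t, ‖covDeriv θ a t‖ ≤ C) : commutatorNorm θ a ≤ C := by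
  refine iSup₂_le fun ψ hψ => ?_
  rw [← ENNReal.ofReal_coe_nnreal]
  refine ENNReal.ofReal_le_ofReal (le_trans ?_ (mul_le_of_le_one_right C.coe_nonneg hψ))
  refine le_of_sq_le_sq ?_ (mul_nonneg C.coe_nonneg (l2Norm_nonneg _))
  have hψc := ψ.2.1.continuous
  have hac := continuous_covDeriv hθ a
  rw [mul_pow, l2Norm_sq, l2Norm_sq, ← intervalIntegral.integral_const_mul]
  simp only [norm_toLp_diracCommutator, ← mul_pow]
  refine intervalIntegral.integral_mono_on (by positivity) ?_ ?_ fun t _ => ?_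
  · exact Continuous.intervalIntegrable (by fun_prop) _ _
  · exact Continuous.intervalIntegrable (by fun_prop) _ _
  · gcongr
    exact (norm_toLp_mulVec_le _ _).trans (by gcongr; exact h t)

theorem exists_contDiff_periodic_bump (t₀ : ℝ) {δ : ℝ} (hδ : 0 < δ) :
    ∃ f : ℝ → ℝ, ContDiff ℝ ∞ f ∧ Function.Periodic f (2 * Real.pi) ∧ 0 < f t₀ ∧
      ∀ t ∈ Set.Icc (t₀ - Real.pi) (t₀ + Real.pi), f t ≠ 0 → |t - t₀| < δ := by
  obtain ⟨ε, hε0, hε⟩ := exists_between (lt_min hδ Real.pi_pos)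
  obtain ⟨hεδ, hεπ⟩ := lt_min_iff.1 hε
  refine ⟨fun t => expNegInvGlue (Real.cos (t - t₀) - Real.cos ε),
    expNegInvGlue.contDiff.comp (by fun_prop), fun t => ?_, ?_, fun t ht hft => ?_⟩
  · simp only [add_sub_right_comm, Real.cos_add_two_pi]
  · refine expNegInvGlue.pos_of_pos (sub_pos.2 ?_)
    rw [sub_self]
    exact Real.cos_lt_cos_of_nonneg_of_le_pi le_rfl hεπ.le hε0
  · contrapose! hft
    refine expNegInvGlue.zero_of_nonpos (sub_nonpos.2 ?_)
    rw [← Real.cos_abs (t - t₀)]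
    exact Real.cos_le_cos_of_nonneg_of_le_pi hε0.le
      (abs_le.2 ⟨by linarith [ht.1], by linarith [ht.2]⟩) (hεδ.le.trans hft)

theorem le_of_forall_integral_sq_mul_le {F : ℝ → ℝ} (hF : Continuous F)
    (hper : Function.Periodic F (2 * Real.pi)) {c : ℝ}
    (h : ∀ f : ℝ → ℝ, ContDiff ℝ ∞ f → Function.Periodic f (2 * Real.pi) →
      ∫ t in (0 : ℝ)..(2 * Real.pi), f t ^ 2 * F t ≤
        ∫ t in (0 : ℝ)..(2 * Real.pi), f t ^ 2 * c) (t₀ : ℝ) : F t₀ ≤ c := by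
  by_contra! hlt
  obtain ⟨δ, hδ, hδF⟩ := Metric.eventually_nhds_iff.1
    (hF.continuousAt.eventually_const_lt hlt)
  obtain ⟨f, hf, hfper, hft₀, hfsupp⟩ := exists_contDiff_periodic_bump t₀ hδ
  have hshift {G : ℝ → ℝ} (hG : Function.Periodic G (2 * Real.pi)) :
      ∫ t in (0 : ℝ)..(2 * Real.pi), G t = ∫ t in (t₀ - Real.pi)..(t₀ + Real.pi), G t := by
    have := hG.intervalIntegral_add_eq 0 (t₀ - Real.pi)
    rwa [zero_add, show t₀ - Real.pi + 2 * Real.pi = t₀ + Real.pi by ring] at this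
  have hle := h f hf hfper
  rw [hshift fun t => by simp only [hfper t, hper t], hshift fun t => by simp only [hfper t]] at hle
  have hfc := hf.continuous
  refine hle.not_gt (intervalIntegral.integral_lt_integral_of_continuousOn_of_le_of_exists_lt
    (by linarith [Real.pi_pos]) (by fun_prop) (by fun_prop) (fun t ht => ?_) ⟨t₀, ?_, by gcongr⟩)
  · by_cases hft : f t = 0
    · simp [hft]
    · have := hδF (hfsupp t ⟨ht.1.le, ht.2⟩ hft)
      gcongr
  · constructor <;> linarith [Real.pi_pos]

theorem norm_covDeriv_le (hθ : ∀ j, Continuous (θ j))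
    (hper : ∀ j, Function.Periodic (θ j) (2 * Real.pi)) (h : commutatorNorm θ a ≤ C) (t : ℝ) :
    ‖covDeriv θ a t‖ ≤ C := by
  refine opNorm_le_of_forall_norm_mulVec_le C.coe_nonneg fun v => ?_
  refine le_of_sq_le_sq ?_ (by positivity)
  have hac := continuous_covDeriv hθ a
  refine le_of_forall_integral_sq_mul_le (F := fun t => ‖WithLp.toLp 2 (covDeriv θ a t *ᵥ v)‖ ^ 2)
    (by fun_prop) (fun s => by simp only [covDeriv_periodic hper a s]) (fun f hf hfper => ?_) t
  let ψ : spinors n := ⟨fun s => (f s : ℂ) • v,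
    (Complex.ofRealCLM.contDiff.comp hf).smul contDiff_const, fun s => by simp only [hfper s]⟩
  have hle := pow_le_pow_left₀ (l2Norm_nonneg _) (l2Norm_diracCommutator_le h ψ) 2
  rw [mul_pow, l2Norm_sq, l2Norm_sq, ← intervalIntegral.integral_const_mul] at hle
  simp only [norm_toLp_diracCommutator θ a ψ] at hle
  simp only [ψ, Matrix.mulVec_smul, WithLp.toLp_smul, norm_smul,
    Complex.norm_real, mul_pow, Real.norm_eq_abs, sq_abs] at hle
  simpa only [mul_pow, mul_left_comm] using hle

theorem commutatorNorm_le_iff (hθ : ∀ j, Continuous (θ j))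
    (hper : ∀ j, Function.Periodic (θ j) (2 * Real.pi)) :
    commutatorNorm θ a ≤ C ↔ ∀ t, ‖covDeriv θ a t‖ ≤ C :=
  ⟨norm_covDeriv_le hθ hper, commutatorNorm_le_of_norm_covDeriv_le hθ⟩

end Commutator

section Gauge

variable {ι : Type*} [Fintype ι]

/-- The quadratic form `M ↦ ⟨v, M v⟩`, as a linear functional of the matrix `M`. -/
def expectation (v : ι → ℂ) : Matrix ι ι ℂ →ₗ[ℂ] ℂ where
  toFun M := star v ⬝ᵥ M *ᵥ v
  map_add' M N := by rw [Matrix.add_mulVec, dotProduct_add]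
  map_smul' c M := by rw [Matrix.smul_mulVec, dotProduct_smul, RingHom.id_apply]

theorem expectation_eq_sum (v : ι → ℂ) (M : Matrix ι ι ℂ) :
    expectation v M = ∑ i, ∑ j, star (v i) * v j * M i j := by
  change star v ⬝ᵥ M *ᵥ v = _
  simp only [Matrix.mulVec, dotProduct, Finset.mul_sum, Pi.star_apply]
  exact Finset.sum_congr rfl fun i _ => Finset.sum_congr rfl fun j _ => by ring

theorem expectation_star (v : ι → ℂ) (M : Matrix ι ι ℂ) :
    expectation v (star M) = star (expectation v M) := by
  simp only [expectation_eq_sum, star_sum, Matrix.star_apply, star_mul', star_star]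
  rw [Finset.sum_comm]
  exact Finset.sum_congr rfl fun i _ => Finset.sum_congr rfl fun j _ => by ring

theorem expectation_congr {v w : ι → ℂ} (h : ∀ i j, star (v i) * v j = star (w i) * w j) :
    expectation v = expectation w :=
  LinearMap.ext fun M => by simp only [expectation_eq_sum, h]

theorem expectation_eq_inner (v : ι → ℂ) (M : Matrix ι ι ℂ) :
    expectation v M = inner ℂ (WithLp.toLp 2 v) (WithLp.toLp 2 (M *ᵥ v)) := by
  rw [EuclideanSpace.inner_toLp_toLp, dotProduct_comm]
  rfl

variable [DecidableEq ι]

/-- The diagonal unitary matrix with entries `e^{i x_j}`. -/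
def phaseUnitary (x : ι → ℝ) : unitary (Matrix ι ι ℂ) :=
  ⟨Matrix.diagonal fun j => (Circle.exp (x j) : ℂ), by
    simp [Unitary.mem_iff, Matrix.star_eq_conjTranspose, Matrix.diagonal_conjTranspose,
      Complex.conj_mul', Complex.mul_conj']⟩

theorem norm_conjStarAlgAut (U : unitary (Matrix ι ι ℂ)) (M : Matrix ι ι ℂ) :
    ‖Unitary.conjStarAlgAut ℝ (Matrix ι ι ℂ) U M‖ = ‖M‖ := by
  rw [Unitary.conjStarAlgAut_apply, ← Unitary.coe_star, CStarRing.norm_mul_coe_unitary,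
    CStarRing.norm_coe_unitary_mul]

/-- The conjugation by `phaseUnitary x`, which multiplies the entry `(i, j)` of a matrix by
`e^{i (x_i - x_j)}`, as an isometry for the operator norm. -/
def phaseConj (x : ι → ℝ) : Matrix ι ι ℂ ≃ₗᵢ[ℝ] Matrix ι ι ℂ where
  toLinearEquiv :=
    (Unitary.conjStarAlgAut ℝ (Matrix ι ι ℂ) (phaseUnitary x)).toAlgEquiv.toLinearEquiv
  norm_map' := norm_conjStarAlgAut (phaseUnitary x)

theorem phaseConj_apply (x : ι → ℝ) (M : Matrix ι ι ℂ) (i j : ι) :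
    phaseConj x M i j = Circle.exp (x i - x j) * M i j := by
  have hdef : phaseConj x M = phaseUnitary x * M * star (phaseUnitary x : Matrix ι ι ℂ) := rfl
  rw [hdef, sub_eq_add_neg, Circle.exp_add, Circle.exp_neg, Circle.coe_mul, Circle.coe_inv_eq_conj]
  simp [phaseUnitary, Matrix.star_eq_conjTranspose, Matrix.diagonal_conjTranspose, mul_right_comm]

theorem phaseConj_phaseConj (x y : ι → ℝ) (M : Matrix ι ι ℂ) :
    phaseConj x (phaseConj y M) = phaseConj (x + y) M := by
  ext i j
  simp only [phaseConj_apply, Pi.add_apply, ← mul_assoc, ← Circle.coe_mul, ← Circle.exp_add]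
  rw [add_sub_add_comm]

theorem phaseConj_zero (M : Matrix ι ι ℂ) : phaseConj 0 M = M := by
  ext i j
  simp [phaseConj_apply]

theorem phaseConj_smul (x : ι → ℝ) (c : ℂ) (M : Matrix ι ι ℂ) :
    phaseConj x (c • M) = c • phaseConj x M := by
  ext i j
  simp [phaseConj_apply, mul_left_comm]

theorem phaseConj_star (x : ι → ℝ) (M : Matrix ι ι ℂ) :
    phaseConj x (star M) = star (phaseConj x M) :=
  map_star (Unitary.conjStarAlgAut ℝ (Matrix ι ι ℂ) (phaseUnitary x)) M

theorem norm_expectation_le (v : ι → ℂ) (M : Matrix ι ι ℂ) :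
    ‖expectation v M‖ ≤ ‖WithLp.toLp 2 v‖ ^ 2 * ‖M‖ := by
  rw [expectation_eq_inner]
  calc _ ≤ ‖WithLp.toLp 2 v‖ * ‖WithLp.toLp 2 (M *ᵥ v)‖ := norm_inner_le_norm _ _
    _ ≤ ‖WithLp.toLp 2 v‖ * (‖M‖ * ‖WithLp.toLp 2 v‖) := by
      gcongr
      exact norm_toLp_mulVec_le M v
    _ = ‖WithLp.toLp 2 v‖ ^ 2 * ‖M‖ := by ring

end Gauge

section Transport

variable {n : ℕ} {θ : Fin n → ℝ → ℝ} {a : loopAlgebra n} {C : ℝ≥0}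

theorem Theta_zero (θ : Fin n → ℝ → ℝ) (j : Fin n) : Theta θ j 0 = 0 :=
  intervalIntegral.integral_same

theorem hasDerivAt_Theta (hθ : ∀ j, Continuous (θ j)) (j : Fin n) (t : ℝ) :
    HasDerivAt (Theta θ j) (θ j t) t :=
  intervalIntegral.integral_hasDerivAt_right ((hθ j).intervalIntegrable _ _)
    ((hθ j).stronglyMeasurableAtFilter _ _) (hθ j).continuousAt

theorem contDiff_Theta (hθ : ∀ j, ContDiff ℝ ∞ (θ j)) (j : Fin n) : ContDiff ℝ ∞ (Theta θ j) := by
  have h := hasDerivAt_Theta (fun j => (hθ j).continuous) j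
  refine contDiff_infty_iff_deriv.2 ⟨fun t => (h t).differentiableAt, ?_⟩
  rw [funext fun t => (h t).deriv]
  exact hθ j

/-- The phases `Θ_j(2π)` of the holonomy of the connection. -/
def holonomy (θ : Fin n → ℝ → ℝ) (j : Fin n) : ℝ :=
  Theta θ j (2 * Real.pi)

theorem Theta_add_int_mul_two_pi (hθ : ∀ j, Continuous (θ j))
    (hper : ∀ j, Function.Periodic (θ j) (2 * Real.pi)) (j : Fin n) (t : ℝ) (m : ℤ) :
    Theta θ j (t + m * (2 * Real.pi)) = Theta θ j t + m * holonomy θ j := by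
  have hint (a b : ℝ) : IntervalIntegrable (θ j) volume a b := (hθ j).intervalIntegrable a b
  have h := (hper j).intervalIntegral_add_zsmul_eq m t hint
  rw [zsmul_eq_mul, zsmul_eq_mul] at h
  rw [Theta, ← intervalIntegral.integral_add_adjacent_intervals (hint 0 t) (hint _ _), h,
    (hper j).intervalIntegral_add_eq t 0, zero_add]
  rfl

theorem Theta_add_two_pi (hθ : ∀ j, Continuous (θ j))
    (hper : ∀ j, Function.Periodic (θ j) (2 * Real.pi)) (j : Fin n) (t : ℝ) :
    Theta θ j (t + 2 * Real.pi) = Theta θ j t + holonomy θ j := by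
  simpa using Theta_add_int_mul_two_pi hθ hper j t 1

/-- The observable `a(t)` transported back to the fibre over `0` along the connection. -/
def transport (θ : Fin n → ℝ → ℝ) (a : ℝ → Matrix (Fin n) (Fin n) ℂ) (t : ℝ) :
    Matrix (Fin n) (Fin n) ℂ :=
  phaseConj (fun j => Theta θ j t) (a t)

theorem hasDerivAt_coe_circleExp {x : ℝ → ℝ} {x' t : ℝ} (hx : HasDerivAt x x' t) :
    HasDerivAt (fun s => (Circle.exp (x s) : ℂ)) (Complex.I * x' * Circle.exp (x t)) t := by
  simp only [Circle.coe_exp]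
  exact (hx.ofReal_comp.mul_const Complex.I).cexp.congr_deriv (by ring)

theorem hasDerivAt_transport (hθ : ∀ j, Continuous (θ j)) (a : loopAlgebra n) (t : ℝ) :
    HasDerivAt (transport θ a) (phaseConj (fun j => Theta θ j t) (covDeriv θ a t)) t := by
  refine hasDerivAt_matrix.2 fun i j => ?_
  simp only [transport, phaseConj_apply]
  have hphase := hasDerivAt_coe_circleExp
    ((hasDerivAt_Theta hθ i t).fun_sub (hasDerivAt_Theta hθ j t))
  refine (hphase.mul (hasDerivAt_matrix.1 (hasDerivAt_coe_loopAlgebra a t) i j)).congr_deriv ?_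
  simp only [covDeriv, Ring.lie_def, gaugeField, Matrix.add_apply, Matrix.sub_apply,
    Matrix.diagonal_mul, Matrix.mul_diagonal]
  push_cast
  ring

theorem commutatorNorm_le_iff_lipschitzWith (hθ : ∀ j, Continuous (θ j))
    (hper : ∀ j, Function.Periodic (θ j) (2 * Real.pi)) :
    commutatorNorm θ a ≤ C ↔ LipschitzWith C (transport θ a) := by
  have hderiv (t : ℝ) : ‖deriv (transport θ a) t‖ = ‖covDeriv θ a t‖ := by
    rw [(hasDerivAt_transport hθ a t).deriv, LinearIsometryEquiv.norm_map]
  simp only [commutatorNorm_le_iff hθ hper, ← hderiv]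
  exact ⟨lipschitzWith_of_nnnorm_deriv_le fun t => (hasDerivAt_transport hθ a t).differentiableAt,
    fun h t => norm_deriv_le_of_lipschitz h⟩

theorem transport_add_two_pi (hθ : ∀ j, Continuous (θ j))
    (hper : ∀ j, Function.Periodic (θ j) (2 * Real.pi)) (a : loopAlgebra n) (t : ℝ) :
    transport θ a (t + 2 * Real.pi) = phaseConj (holonomy θ) (transport θ a t) := by
  rw [transport, transport, phaseConj_phaseConj, a.2.2 t, add_comm (holonomy θ)]
  simp only [Theta_add_two_pi hθ hper]
  rfl

theorem exists_transport_eq (hθ : ∀ j, ContDiff ℝ ∞ (θ j))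
    (hper : ∀ j, Function.Periodic (θ j) (2 * Real.pi)) {b : ℝ → Matrix (Fin n) (Fin n) ℂ}
    (hb : ContDiff ℝ ∞ b) (hbper : ∀ t, b (t + 2 * Real.pi) = phaseConj (holonomy θ) (b t)) :
    ∃ a : loopAlgebra n, transport θ a = b := by
  refine ⟨⟨fun t => phaseConj (-fun j => Theta θ j t) (b t), fun i j => ?_, fun t => ?_⟩, ?_⟩
  · simp only [phaseConj_apply, Circle.coe_exp, Pi.neg_apply]
    have hi := contDiff_Theta hθ i
    have hj := contDiff_Theta hθ j
    have hbij := contDiff_matrix.1 hb i j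
    exact (Complex.contDiff_exp.comp ((Complex.ofRealCLM.contDiff.comp
      (hi.neg.sub hj.neg)).mul contDiff_const)).mul hbij
  · simp only [hbper, phaseConj_phaseConj]
    congr 2
    funext j
    simp [Theta_add_two_pi (fun j => (hθ j).continuous) hper]
  · funext t
    rw [transport, phaseConj_phaseConj, add_neg_cancel, phaseConj_zero]

theorem liftVec_apply (θ : Fin n → ℝ → ℝ) (v : Fin n → ℂ) (t : ℝ) (j : Fin n) :
    liftVec θ v t j = Circle.exp (-Theta θ j t) * v j := by
  rw [liftVec, mul_comm, Circle.coe_exp]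
  push_cast
  ring_nf

theorem liftVec_zero (θ : Fin n → ℝ → ℝ) (v : Fin n → ℂ) : liftVec θ v 0 = v := by
  funext j
  simp [liftVec_apply, Theta_zero]

theorem vectorState_liftVec (θ : Fin n → ℝ → ℝ) (v : Fin n → ℂ) (t : ℝ) (a : loopAlgebra n) :
    vectorState t (liftVec θ v t) a = expectation v (transport θ a t) := by
  change expectation (liftVec θ v t) (a.1 t) = _
  simp only [expectation_eq_sum, liftVec_apply, transport, phaseConj_apply, star_mul',
    Complex.star_def, ← Circle.coe_inv_eq_conj, ← Circle.exp_neg, neg_neg, sub_eq_add_neg,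
    Circle.exp_add, Circle.coe_mul]
  exact Finset.sum_congr rfl fun i _ => Finset.sum_congr rfl fun j _ => by ring

end Transport

section Quasiperiodic

variable {E : Type*} [NormedAddCommGroup E] [NormedSpace ℝ E] {U : E ≃ₗᵢ[ℝ] E} {p : ℝ}

/-- The functions on the line whose translation by `p` amounts to applying the isometry `U`,
that is the sections of the flat bundle over `ℝ / pℤ` with monodromy `U`. -/
def IsQuasiperiodic (U : E ≃ₗᵢ[ℝ] E) (p : ℝ) (b : ℝ → E) : Prop :=
  ∀ t, b (t + p) = U (b t)

/-- The quasi-periodic function that agrees with `β` on `[0, p)`. -/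
def quasiExtension (U : E ≃ₗᵢ[ℝ] E) (hp : 0 < p) (β : ℝ → E) (t : ℝ) : E :=
  (U ^ toIcoDiv hp 0 t) (β (toIcoMod hp 0 t))

theorem isQuasiperiodic_quasiExtension (U : E ≃ₗᵢ[ℝ] E) (hp : 0 < p) (β : ℝ → E) :
    IsQuasiperiodic U p (quasiExtension U hp β) := fun t => by
  rw [quasiExtension, toIcoDiv_add_right, toIcoMod_add_right, add_comm, zpow_one_add]
  rfl

theorem quasiExtension_of_mem_Ico (U : E ≃ₗᵢ[ℝ] E) (hp : 0 < p) (β : ℝ → E) {t : ℝ}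
    (ht : t ∈ Set.Ico 0 p) : quasiExtension U hp β t = β t := by
  have hdiv : toIcoDiv hp 0 t = 0 := (toIcoDiv_eq_iff hp).2 (by simpa using ht)
  rw [quasiExtension, hdiv, toIcoMod, hdiv, zpow_zero, zero_smul, sub_zero]
  rfl

theorem stronglyMeasurable_quasiExtension (U : E ≃ₗᵢ[ℝ] E) (hp : 0 < p) {β : ℝ → E}
    (hβ : StronglyMeasurable β) : StronglyMeasurable (quasiExtension U hp β) := by
  have hdiv : Measurable (toIcoDiv hp (0 : ℝ)) := by
    rw [show toIcoDiv hp (0 : ℝ) = _ from funext fun t => toIcoDiv_eq_floor hp 0 t]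
    fun_prop
  have hmod : Measurable (toIcoMod hp (0 : ℝ)) := by
    change Measurable fun t => t - toIcoDiv hp 0 t • p
    simp only [zsmul_eq_mul]
    fun_prop
  have hact : Continuous fun x : ℤ × E => (U ^ x.1) x.2 :=
    continuous_prod_of_discrete_left.2 fun m => (U ^ m).continuous
  exact hact.comp_stronglyMeasurable
    (hdiv.stronglyMeasurable.prodMk (hβ.comp_measurable hmod))

theorem isQuasiperiodic_primitive [CompleteSpace E] {β : ℝ → E} (hβ : IsQuasiperiodic U p β)
    (hint : ∀ s t, IntervalIntegrable β volume s t) {e : E} (he : ∫ t in 0..p, β t = U e - e) :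
    IsQuasiperiodic U p fun t => e + ∫ s in 0..t, β s := fun t => by
  have hshift : ∫ s in p..(t + p), β s = U (∫ s in 0..t, β s) := by
    have hcov := intervalIntegral.integral_comp_add_right (a := 0) (b := t) β p
    rw [zero_add] at hcov
    simp only [← hcov, hβ _]
    exact U.toContinuousLinearEquiv.toContinuousLinearMap.intervalIntegral_comp_comm (hint 0 t)
  dsimp only
  rw [← intervalIntegral.integral_add_adjacent_intervals (hint 0 p) (hint p _), he, hshift, map_add]
  abel

theorem lipschitzWith_primitive {β : ℝ → E} (e : E) {C : ℝ≥0}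
    (hint : ∀ s t, IntervalIntegrable β volume s t) (hβ : ∀ t, ‖β t‖ ≤ C) :
    LipschitzWith C fun t => e + ∫ s in 0..t, β s := by
  refine LipschitzWith.of_dist_le_mul fun s t => ?_
  rw [dist_add_left, dist_eq_norm,
    intervalIntegral.integral_interval_sub_left (hint _ _) (hint _ _), Real.dist_eq]
  exact intervalIntegral.norm_integral_le_of_norm_le_const fun u _ => hβ u

theorem norm_inv_smul_le_one {c : ℝ} {e : E} (he : ‖e‖ ≤ c) : ‖c⁻¹ • e‖ ≤ 1 := by
  have hc : 0 ≤ c := (norm_nonneg e).trans he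
  rw [norm_smul, norm_inv, Real.norm_of_nonneg hc]
  exact inv_mul_le_one_of_le₀ he hc

theorem smul_inv_smul_of_norm_le {c : ℝ} {e : E} (he : ‖e‖ ≤ c) : c • c⁻¹ • e = e := by
  rcases eq_or_ne c 0 with rfl | hc
  · simp [norm_le_zero_iff.1 he]
  · exact smul_inv_smul₀ hc e

theorem exists_lipschitzWith_isQuasiperiodic [CompleteSpace E] (hp : 0 < p) {τ : ℝ} (h0 : 0 ≤ τ)
    (h1 : τ ≤ p) {e₀ e₁ : E} (he : ‖e₁ - e₀‖ ≤ τ) (he' : ‖U e₀ - e₁‖ ≤ p - τ) :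
    ∃ b : ℝ → E, LipschitzWith 1 b ∧ IsQuasiperiodic U p b ∧ b 0 = e₀ ∧ b τ = e₁ := by
  let step (t : ℝ) : E := if t < τ then τ⁻¹ • (e₁ - e₀) else (p - τ)⁻¹ • (U e₀ - e₁)
  let β := quasiExtension U hp step
  have hstep : StronglyMeasurable step :=
    .ite measurableSet_Iio stronglyMeasurable_const stronglyMeasurable_const
  have hnorm (t : ℝ) : ‖β t‖ ≤ 1 := by
    simp only [β, quasiExtension, LinearIsometryEquiv.norm_map, step]
    split_ifs
    exacts [norm_inv_smul_le_one he, norm_inv_smul_le_one he']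
  have hint (s t : ℝ) : IntervalIntegrable β volume s t :=
    (intervalIntegrable_const (c := (1 : ℝ))).mono_fun
      (stronglyMeasurable_quasiExtension U hp hstep).aestronglyMeasurable
      (Filter.Eventually.of_forall fun u => by simpa using hnorm u)
  have hfirst : ∫ t in 0..τ, β t = e₁ - e₀ := calc
    _ = ∫ _ in 0..τ, τ⁻¹ • (e₁ - e₀) :=
      intervalIntegral.integral_congr_Ioo_of_le h0 fun t ht =>
        (quasiExtension_of_mem_Ico U hp step ⟨ht.1.le, ht.2.trans_le h1⟩).trans (if_pos ht.2)
    _ = e₁ - e₀ := by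
      rw [intervalIntegral.integral_const, sub_zero, smul_inv_smul_of_norm_le he]
  have hsecond : ∫ t in τ..p, β t = U e₀ - e₁ := calc
    _ = ∫ _ in τ..p, (p - τ)⁻¹ • (U e₀ - e₁) :=
      intervalIntegral.integral_congr_Ioo_of_le h1 fun t ht =>
        (quasiExtension_of_mem_Ico U hp step ⟨h0.trans ht.1.le, ht.2⟩).trans
          (if_neg ht.1.not_gt)
    _ = U e₀ - e₁ := by rw [intervalIntegral.integral_const, smul_inv_smul_of_norm_le he']
  have hturn : ∫ t in 0..p, β t = U e₀ - e₀ := by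
    rw [← intervalIntegral.integral_add_adjacent_intervals (hint 0 τ) (hint τ p), hfirst, hsecond]
    abel
  exact ⟨fun t => e₀ + ∫ s in 0..t, β s, lipschitzWith_primitive e₀ hint hnorm,
    isQuasiperiodic_primitive (isQuasiperiodic_quasiExtension U hp step) hint hturn,
    by simp, by simp [hfirst]⟩

theorem exists_contDiff_isQuasiperiodic [CompleteSpace E] {b : ℝ → E} (hb : LipschitzWith 1 b)
    (hq : IsQuasiperiodic U p b) {ε : ℝ} (hε : 0 < ε) :
    ∃ c : ℝ → E, ContDiff ℝ ∞ c ∧ LipschitzWith 1 c ∧ IsQuasiperiodic U p c ∧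
      ∀ t, ‖c t - b t‖ ≤ ε := by
  let φ : ContDiffBump (0 : ℝ) := ⟨ε / 2, ε, by positivity, by linarith⟩
  have hbc := hb.continuous
  have hφc : Continuous (φ.normed volume) := φ.continuous_normed
  have hint (y : ℝ) : Integrable fun t => φ.normed volume t • b (y - t) :=
    Continuous.integrable_of_hasCompactSupport (by fun_prop)
      φ.hasCompactSupport_normed.smul_right
  refine ⟨convolution (φ.normed volume) b (ContinuousLinearMap.lsmul ℝ ℝ) volume,
    φ.hasCompactSupport_normed.contDiff_convolution_left _ φ.contDiff_normed
      hbc.locallyIntegrable, LipschitzWith.of_dist_le_mul fun s t => ?_, fun t => ?_, fun t => ?_⟩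
  · simp only [convolution_def, ContinuousLinearMap.lsmul_apply]
    rw [dist_eq_norm, ← integral_sub (hint s) (hint t)]
    calc _ ≤ ∫ u, φ.normed volume u * dist s t := by
          refine norm_integral_le_of_norm_le (φ.integrable_normed.mul_const _)
            (.of_forall fun u => ?_)
          rw [← smul_sub, norm_smul, Real.norm_of_nonneg (φ.nonneg_normed u), ← dist_eq_norm]
          gcongr
          · exact φ.nonneg_normed u
          · simpa using hb.dist_le_mul (s - u) (t - u)
      _ = 1 * dist s t := by rw [integral_mul_const, φ.integral_normed]
  · simp only [convolution_def, ContinuousLinearMap.lsmul_apply, add_sub_right_comm t p, hq _,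
      ← map_smul]
    exact U.toContinuousLinearEquiv.toContinuousLinearMap.integral_comp_comm (hint t)
  · rw [← dist_eq_norm]
    refine φ.dist_normed_convolution_le hbc.aestronglyMeasurable fun u hu => ?_
    calc dist (b u) (b t) ≤ 1 * dist u t := hb.dist_le_mul u t
      _ ≤ ε := by rw [one_mul]; exact (Metric.mem_ball.1 hu).le

end Quasiperiodic

section ObservablePairs

variable {ι : Type*} [Fintype ι]

theorem expectation_realPart (v : ι → ℂ) (M : Matrix ι ι ℂ) :
    expectation v (realPart M) = (expectation v M).re := by
  rw [realPart_apply_coe, ← Complex.coe_smul, map_smul, map_add, expectation_star, Complex.star_def,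
    Complex.re_eq_add_conj, smul_eq_mul]
  push_cast
  ring

variable [DecidableEq ι] {x : ι → ℝ} {B₀ B₁ : Matrix ι ι ℂ}

theorem phaseConj_realPart (x : ι → ℝ) (M : Matrix ι ι ℂ) :
    phaseConj x (realPart M) = realPart (phaseConj x M) := by
  rw [realPart_apply_coe, realPart_apply_coe, map_smul, map_add, phaseConj_star]

theorem norm_realPart_smul_le {c : ℂ} (hc : ‖c‖ = 1) (M : Matrix ι ι ℂ) :
    ‖(realPart (c • M) : Matrix ι ι ℂ)‖ ≤ ‖M‖ :=
  (realPart.norm_le (c • M)).trans_eq (by rw [norm_smul, hc, one_mul])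

/-- The possible values at `0` and `τ` of the Hermitian observables of Lipschitz constant one that
are quasi-periodic for the conjugation by the holonomy `x`, the period being `2π`. -/
def observablePairs (x : ι → ℝ) (τ : ℝ) : Set (Matrix ι ι ℂ × Matrix ι ι ℂ) :=
  {B | IsSelfAdjoint B.1 ∧ IsSelfAdjoint B.2 ∧ ‖B.2 - B.1‖ ≤ τ ∧
    ‖phaseConj x B.1 - B.2‖ ≤ 2 * Real.pi - τ}

theorem realPart_smul_mem_observablePairs {τ : ℝ} {c : ℂ} (hc : ‖c‖ = 1)
    (hB : ‖B₁ - B₀‖ ≤ τ) (hB' : ‖phaseConj x B₀ - B₁‖ ≤ 2 * Real.pi - τ) :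
    ((realPart (c • B₀) : Matrix ι ι ℂ), (realPart (c • B₁) : Matrix ι ι ℂ)) ∈
      observablePairs x τ := by
  refine ⟨(realPart _).2, (realPart _).2, ?_, ?_⟩
  · simp only [← AddSubgroupClass.coe_sub, ← map_sub, ← smul_sub]
    exact (norm_realPart_smul_le hc _).trans hB
  · simp only [phaseConj_realPart, phaseConj_smul, ← AddSubgroupClass.coe_sub, ← map_sub,
      ← smul_sub]
    exact (norm_realPart_smul_le hc _).trans hB'

end ObservablePairs

section SpectralDist

variable {n : ℕ} {θ : Fin n → ℝ → ℝ} {τ : ℝ} {v w : Fin n → ℂ}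

theorem exists_mem_observablePairs (hθ : ∀ j, Continuous (θ j))
    (hper : ∀ j, Function.Periodic (θ j) (2 * Real.pi)) (h0 : 0 ≤ τ) (h1 : τ ≤ 2 * Real.pi)
    (v w : Fin n → ℂ) {a : loopAlgebra n} (ha : commutatorNorm θ a ≤ 1) :
    ∃ B ∈ observablePairs (holonomy θ) τ,
      ‖vectorState 0 v a - vectorState τ (liftVec θ w τ) a‖ =
        ‖expectation v B.1 - expectation w B.2‖ := by
  have hlip : LipschitzWith 1 (transport θ a) :=
    (commutatorNorm_le_iff_lipschitzWith hθ hper).1 (by simpa using ha)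
  have hstep (s t : ℝ) (hst : s ≤ t) : ‖transport θ a t - transport θ a s‖ ≤ t - s := by
    simpa [dist_eq_norm, abs_of_nonneg (sub_nonneg.2 hst)] using hlip.dist_le_mul t s
  have hend : transport θ a (2 * Real.pi) = phaseConj (holonomy θ) (transport θ a 0) := by
    simpa using transport_add_two_pi hθ hper a 0
  have hv : vectorState 0 v a = expectation v (transport θ a 0) := by
    rw [← vectorState_liftVec, liftVec_zero]
  rw [hv, vectorState_liftVec]
  -- The phase `c` makes the difference real, so that taking real parts does not shrink it.
  obtain ⟨c, hc, hcS⟩ := RCLike.exists_norm_eq_mul_self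
    (expectation v (transport θ a 0) - expectation w (transport θ a τ))
  refine ⟨_, realPart_smul_mem_observablePairs hc (by simpa using hstep 0 τ h0)
    (by simpa [hend] using hstep τ _ h1), ?_⟩
  rw [expectation_realPart, expectation_realPart, map_smul, map_smul, ← Complex.ofReal_sub,
    ← Complex.sub_re, ← smul_sub, smul_eq_mul, ← hcS, RCLike.ofReal_eq_complex_ofReal,
    Complex.ofReal_re, Complex.norm_real, norm_norm]

theorem le_spectralDist {p q : loopAlgebra n →ₗ[ℂ] ℂ} {a : loopAlgebra n}
    (ha : commutatorNorm θ a ≤ 1) : ENNReal.ofReal ‖p a - q a‖ ≤ spectralDist θ p q :=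
  le_iSup₂ (f := fun (a : loopAlgebra n) (_ : commutatorNorm θ a ≤ 1) =>
    ENNReal.ofReal ‖p a - q a‖) a ha

theorem ofReal_norm_expectation_sub_le_spectralDist (hθ : ∀ j, ContDiff ℝ ∞ (θ j))
    (hper : ∀ j, Function.Periodic (θ j) (2 * Real.pi)) (h0 : 0 ≤ τ) (h1 : τ ≤ 2 * Real.pi)
    (v w : Fin n → ℂ) {B₀ B₁ : Matrix (Fin n) (Fin n) ℂ} (hB : ‖B₁ - B₀‖ ≤ τ)
    (hB' : ‖phaseConj (holonomy θ) B₀ - B₁‖ ≤ 2 * Real.pi - τ) :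
    ENNReal.ofReal ‖expectation v B₀ - expectation w B₁‖ ≤
      spectralDist θ (vectorState 0 v) (vectorState τ (liftVec θ w τ)) := by
  have : CompleteSpace (Matrix (Fin n) (Fin n) ℂ) := FiniteDimensional.complete ℂ _
  obtain ⟨b, hblip, hbq, rfl, rfl⟩ :=
    exists_lipschitzWith_isQuasiperiodic Real.two_pi_pos h0 h1 hB hB'
  choose c hsmooth hlip hq hclose using fun k : ℕ =>
    exists_contDiff_isQuasiperiodic hblip hbq (Nat.one_div_pos_of_nat (α := ℝ) (n := k))
  choose a ha using fun k => exists_transport_eq hθ hper (hsmooth k) (hq k)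
  have hlim (t : ℝ) : Filter.Tendsto (c · t) Filter.atTop (nhds (b t)) :=
    tendsto_iff_norm_sub_tendsto_zero.2 <|
      squeeze_zero (fun _ => norm_nonneg _) (hclose · t) tendsto_one_div_add_atTop_nhds_zero_nat
  have hexp (u : Fin n → ℂ) : Continuous (expectation u) :=
    LinearMap.continuous_of_finiteDimensional _
  have hlimit := ((((hexp v).tendsto _).comp (hlim 0)).sub
    (((hexp w).tendsto _).comp (hlim τ))).norm
  refine le_of_tendsto ((ENNReal.continuous_ofReal.tendsto _).comp hlimit) (.of_forall fun k => ?_)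
  have hcomm : commutatorNorm θ (a k) ≤ (1 : ℝ≥0) := by
    rw [commutatorNorm_le_iff_lipschitzWith (fun j => (hθ j).continuous) hper, ha]
    exact hlip k
  have hv : vectorState 0 v (a k) = expectation v (c k 0) := by
    rw [← ha, ← vectorState_liftVec, liftVec_zero]
  have hw : vectorState τ (liftVec θ w τ) (a k) = expectation w (c k τ) := by
    rw [← ha, ← vectorState_liftVec]
  simpa only [hv, hw, Function.comp_apply] using le_spectralDist (p := vectorState 0 v)
    (q := vectorState τ (liftVec θ w τ)) hcomm

theorem spectralDist_liftVec_eq_iSup (hθ : ∀ j, ContDiff ℝ ∞ (θ j))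
    (hper : ∀ j, Function.Periodic (θ j) (2 * Real.pi)) (h0 : 0 ≤ τ) (h1 : τ ≤ 2 * Real.pi)
    (v w : Fin n → ℂ) :
    spectralDist θ (vectorState 0 v) (vectorState τ (liftVec θ w τ)) =
      ⨆ B ∈ observablePairs (holonomy θ) τ,
        ENNReal.ofReal ‖expectation v B.1 - expectation w B.2‖ := by
  refine le_antisymm (iSup₂_le fun a ha => ?_) (iSup₂_le fun B hB => ?_)
  · obtain ⟨B, hB, hnorm⟩ :=
      exists_mem_observablePairs (fun j => (hθ j).continuous) hper h0 h1 v w ha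
    rw [hnorm]
    exact le_iSup₂ (f := fun (B : _ × _) (_ : B ∈ observablePairs (holonomy θ) τ) =>
      ENNReal.ofReal ‖expectation v B.1 - expectation w B.2‖) B hB
  · exact ofReal_norm_expectation_sub_le_spectralDist hθ hper h0 h1 v w hB.2.2.1 hB.2.2.2

theorem expectation_eq_of_phaseConj_eq (hθ : ∀ j, ContDiff ℝ ∞ (θ j))
    (hper : ∀ j, Function.Periodic (θ j) (2 * Real.pi)) (h0 : 0 ≤ τ) (h1 : τ ≤ 2 * Real.pi)
    (hfin : spectralDist θ (vectorState 0 v) (vectorState τ (liftVec θ w τ)) < ⊤)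
    {B : Matrix (Fin n) (Fin n) ℂ} (hB : phaseConj (holonomy θ) B = B) :
    expectation v B = expectation w B := by
  have hbound (r : ℝ) :
      ENNReal.ofReal (‖(r : ℂ)‖ * ‖expectation v B - expectation w B‖) ≤
        spectralDist θ (vectorState 0 v) (vectorState τ (liftVec θ w τ)) := by
    rw [← norm_mul, mul_sub, ← smul_eq_mul, ← smul_eq_mul, ← map_smul, ← map_smul]
    exact ofReal_norm_expectation_sub_le_spectralDist hθ hper h0 h1 v w (by simpa using h0)
      (by simpa [phaseConj_smul, hB] using h1)
  by_contra hne
  have hpos : 0 < ‖expectation v B - expectation w B‖ := norm_pos_iff.2 (sub_ne_zero.2 hne)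
  obtain ⟨m, hm⟩ := exists_nat_gt ((spectralDist θ (vectorState 0 v)
    (vectorState τ (liftVec θ w τ))).toReal / ‖expectation v B - expectation w B‖)
  refine ((div_lt_iff₀ hpos).1 hm).not_ge ?_
  simpa using (ENNReal.ofReal_le_iff_le_toReal hfin.ne).1 (hbound m)

theorem far_iff {i j : Fin n} : Far θ i j ↔ Circle.exp (holonomy θ i - holonomy θ j) = 1 := by
  simp only [Circle.exp_eq_one, sub_eq_iff_eq_add', Far, holonomy, mul_comm (2 * Real.pi)]

theorem far_refl (θ : Fin n → ℝ → ℝ) (j : Fin n) : Far θ j j := by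
  rw [far_iff, sub_self, Circle.exp_zero]

theorem star_mul_eq_of_far (hθ : ∀ j, ContDiff ℝ ∞ (θ j))
    (hper : ∀ j, Function.Periodic (θ j) (2 * Real.pi)) (h0 : 0 ≤ τ) (h1 : τ ≤ 2 * Real.pi)
    (hfin : spectralDist θ (vectorState 0 v) (vectorState τ (liftVec θ w τ)) < ⊤)
    {i j : Fin n} (hij : Far θ i j) : star (v i) * v j = star (w i) * w j := by
  have hinv : phaseConj (holonomy θ) (Matrix.single i j (1 : ℂ)) = Matrix.single i j 1 := by
    ext k l
    by_cases hkl : i = k ∧ j = l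
    · obtain ⟨rfl, rfl⟩ := hkl
      rw [phaseConj_apply, far_iff.1 hij, Circle.coe_one, one_mul]
    · simp [phaseConj_apply, hkl]
  have hsingle (u : Fin n → ℂ) : expectation u (Matrix.single i j 1) = star (u i) * u j := by
    simp [expectation_eq_sum, Matrix.single_apply, ite_and]
  simpa only [hsingle] using expectation_eq_of_phaseConj_eq hθ hper h0 h1 hfin hinv

end SpectralDist

section Horizontal

variable {n : ℕ} {θ : Fin n → ℝ → ℝ}

theorem hasDerivAt_liftVec (hθ : ∀ j, Continuous (θ j)) (v : Fin n → ℂ) (t : ℝ) :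
    HasDerivAt (liftVec θ v) (-(gaugeField θ t *ᵥ liftVec θ v t)) t := by
  refine hasDerivAt_pi.2 fun j => ?_
  simp only [liftVec_apply]
  refine ((hasDerivAt_coe_circleExp (hasDerivAt_Theta hθ j t).neg).mul_const (v j)).congr_deriv ?_
  simp only [gaugeField, Pi.neg_apply, Matrix.mulVec_diagonal, liftVec_apply]
  push_cast
  ring

theorem isHorizontal_liftVec (hθ : ∀ j, Continuous (θ j)) {γ : ℝ → ℝ} (hγ : ContDiff ℝ 1 γ)
    (v : Fin n → ℂ) : IsHorizontal θ γ fun t => liftVec θ v (γ t) := by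
  refine ⟨hγ, fun t => ?_⟩
  have hderiv := (hγ.differentiable one_ne_zero t).hasDerivAt
  exact ((hasDerivAt_liftVec hθ v (γ t)).scomp t hderiv).congr_deriv
    (by rw [smul_neg, Complex.coe_smul])

theorem IsHorizontal.exists_eq_liftVec (hθ : ∀ j, Continuous (θ j)) {γ : ℝ → ℝ}
    {V : ℝ → Fin n → ℂ} (h : IsHorizontal θ γ V) : ∃ v, ∀ t, V t = liftVec θ v (γ t) := by
  have hconst (j : Fin n) (t : ℝ) :
      HasDerivAt (fun t => (Circle.exp (Theta θ j (γ t)) : ℂ) * V t j) 0 t := by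
    have hγ := (h.1.differentiable one_ne_zero t).hasDerivAt
    refine ((hasDerivAt_coe_circleExp ((hasDerivAt_Theta hθ j (γ t)).comp t hγ)).mul
      (hasDerivAt_pi.1 (h.2 t) j)).congr_deriv ?_
    simp only [gaugeField, Pi.neg_apply, Pi.smul_apply, Matrix.mulVec_diagonal, smul_eq_mul,
      Function.comp_apply]
    push_cast
    ring
  refine ⟨fun j => Circle.exp (Theta θ j (γ 0)) * V 0 j, fun t => funext fun j => ?_⟩
  rw [liftVec_apply, is_const_of_deriv_eq_zero (fun s => (hconst j s).differentiableAt)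
    (fun s => (hconst j s).deriv) 0 t, ← mul_assoc, ← Circle.coe_mul, ← Circle.exp_add,
    neg_add_cancel, Circle.exp_zero, Circle.coe_one, one_mul]

theorem horizontalDist_liftVec_lt_top (hθ : ∀ j, Continuous (θ j)) (v : Fin n → ℂ) (τ : ℝ) :
    horizontalDist θ (vectorState 0 v) (vectorState τ (liftVec θ v τ)) < ⊤ := by
  simp only [horizontalDist, iInf_lt_iff]
  exact ⟨fun t => τ * t, fun t => liftVec θ v (τ * t), isHorizontal_liftVec hθ (by fun_prop) v,
    by simp [liftVec_zero], by simp, ENNReal.ofReal_lt_top⟩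

theorem spectralDist_liftVec_liftVec_le (hθ : ∀ j, Continuous (θ j))
    (hper : ∀ j, Function.Periodic (θ j) (2 * Real.pi)) (v : Fin n → ℂ) (s t : ℝ) :
    spectralDist θ (vectorState s (liftVec θ v s)) (vectorState t (liftVec θ v t)) ≤
      ENNReal.ofReal (‖WithLp.toLp 2 v‖ ^ 2 * |s - t|) := by
  refine iSup₂_le fun a ha => ENNReal.ofReal_le_ofReal ?_
  have hlip : LipschitzWith 1 (transport θ a) :=
    (commutatorNorm_le_iff_lipschitzWith hθ hper).1 (by simpa using ha)
  rw [vectorState_liftVec, vectorState_liftVec, ← map_sub]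
  refine (norm_expectation_le v _).trans ?_
  gcongr
  simpa [dist_eq_norm] using hlip.dist_le_mul s t

theorem spectralDist_lt_top_of_horizontalDist_lt_top (hθ : ∀ j, Continuous (θ j))
    (hper : ∀ j, Function.Periodic (θ j) (2 * Real.pi)) {p q : loopAlgebra n →ₗ[ℂ] ℂ}
    (h : horizontalDist θ p q < ⊤) : spectralDist θ p q < ⊤ := by
  simp only [horizontalDist, iInf_lt_iff] at h
  obtain ⟨γ, V, hV, rfl, rfl, -⟩ := h
  obtain ⟨v, hv⟩ := hV.exists_eq_liftVec hθ
  rw [hv, hv]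
  exact (spectralDist_liftVec_liftVec_le hθ hper v _ _).trans_lt ENNReal.ofReal_lt_top

theorem periodic_vectorState (u : Fin n → ℂ) :
    Function.Periodic (fun t => vectorState t u) (2 * Real.pi) := fun t =>
  LinearMap.ext fun a => congrArg (expectation u) (a.2.2 t)

theorem vectorState_congr {v w : Fin n → ℂ} (h : ∀ i j, star (v i) * v j = star (w i) * w j)
    (t : ℝ) : vectorState t v = vectorState t w :=
  LinearMap.ext fun a => congrArg (fun f => f (a.1 t)) (expectation_congr h)

theorem exists_mem_Icc_vectorState_eq (θ : Fin n → ℝ → ℝ) (t : ℝ) (u : Fin n → ℂ) :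
    ∃ τ ∈ Set.Icc 0 (2 * Real.pi), ∃ w,
      vectorState t u = vectorState τ (liftVec θ w τ) ∧ ∀ j, ‖w j‖ = ‖u j‖ := by
  obtain ⟨τ, hτ, htτ⟩ := (periodic_vectorState u).exists_mem_Ico₀ Real.two_pi_pos t
  refine ⟨τ, Set.Ico_subset_Icc_self hτ, fun j => Circle.exp (Theta θ j τ) * u j, ?_, by simp⟩
  have hlift : liftVec θ (fun j => Circle.exp (Theta θ j τ) * u j) τ = u := funext fun j => by
    rw [liftVec_apply, ← mul_assoc, ← Circle.coe_mul, ← Circle.exp_add, neg_add_cancel,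
      Circle.exp_zero, Circle.coe_one, one_mul]
  rw [hlift]
  exact htτ

end Horizontal

section TrivialHolonomy

variable {n : ℕ} {θ : Fin n → ℝ → ℝ} {τ : ℝ} {v : Fin n → ℂ}

theorem vectorState_liftVec_congr {w : Fin n → ℂ} (h : ∀ i j, star (v i) * v j = star (w i) * w j)
    (t : ℝ) : vectorState t (liftVec θ v t) = vectorState t (liftVec θ w t) :=
  LinearMap.ext fun a => by rw [vectorState_liftVec, vectorState_liftVec, expectation_congr h]

theorem norm_toLp_sq {ι : Type*} [Fintype ι] (v : ι → ℂ) :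
    ((‖WithLp.toLp 2 v‖ ^ 2 : ℝ) : ℂ) = star v ⬝ᵥ v := by
  rw [dotProduct_comm, ← EuclideanSpace.inner_toLp_toLp, inner_self_eq_norm_sq_to_K]
  norm_cast

theorem phaseConj_holonomy_eq_self (hfar : ∀ i j, Far θ i j) (B : Matrix (Fin n) (Fin n) ℂ) :
    phaseConj (holonomy θ) B = B := by
  ext i j
  rw [phaseConj_apply, far_iff.1 (hfar i j), Circle.coe_one, one_mul]

theorem spectralDist_liftVec_of_forall_far (hθ : ∀ j, ContDiff ℝ ∞ (θ j))
    (hper : ∀ j, Function.Periodic (θ j) (2 * Real.pi)) (hfar : ∀ i j, Far θ i j) (h0 : 0 ≤ τ)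
    (h1 : τ ≤ 2 * Real.pi) (hv : star v ⬝ᵥ v = 1) :
    spectralDist θ (vectorState 0 v) (vectorState τ (liftVec θ v τ)) =
      ENNReal.ofReal (min τ (2 * Real.pi - τ)) := by
  have hnorm : ‖WithLp.toLp 2 v‖ ^ 2 = 1 := by exact_mod_cast (norm_toLp_sq v).trans hv
  refine le_antisymm ?_ ?_
  · rw [spectralDist_liftVec_eq_iSup hθ hper h0 h1]
    refine iSup₂_le fun B ⟨_, _, hB, hB'⟩ => ENNReal.ofReal_le_ofReal ?_
    rw [phaseConj_holonomy_eq_self hfar] at hB'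
    rw [← map_sub]
    refine (norm_expectation_le v _).trans ?_
    rw [hnorm, one_mul]
    exact le_min (norm_sub_rev B.1 B.2 ▸ hB) hB'
  · set m := min τ (2 * Real.pi - τ)
    have hm : 0 ≤ m := le_min h0 (by linarith)
    have hone : ‖(m : ℂ) • (1 : Matrix (Fin n) (Fin n) ℂ)‖ ≤ m :=
      opNorm_le_of_forall_norm_mulVec_le hm fun u => by
        rw [Matrix.smul_mulVec, Matrix.one_mulVec, WithLp.toLp_smul, norm_smul,
          Complex.norm_of_nonneg hm]
    have hexp : expectation v 1 = 1 := (congrArg (star v ⬝ᵥ ·) (Matrix.one_mulVec v)).trans hv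
    have hlower := ofReal_norm_expectation_sub_le_spectralDist hθ hper h0 h1 v v
      (B₀ := 0) (B₁ := (m : ℂ) • 1)
      (by simpa using hone.trans (min_le_left _ _)) (by simpa using hone.trans (min_le_right _ _))
    rwa [map_zero, zero_sub, norm_neg, map_smul, hexp, smul_eq_mul, mul_one,
      Complex.norm_of_nonneg hm] at hlower

theorem Con_eq_Acc_of_forall_far (hθ : ∀ j, ContDiff ℝ ∞ (θ j))
    (hper : ∀ j, Function.Periodic (θ j) (2 * Real.pi)) (hfar : ∀ i j, Far θ i j)
    (v : Fin n → ℂ) : Con θ (vectorState 0 v) = Acc θ (vectorState 0 v) := by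
  refine Set.Subset.antisymm (fun q ⟨hq, hfin⟩ => ⟨hq, ?_⟩) fun q ⟨hq, hfin⟩ =>
    ⟨hq, spectralDist_lt_top_of_horizontalDist_lt_top (fun j => (hθ j).continuous) hper hfin⟩
  obtain ⟨t, u, -, rfl⟩ := hq
  obtain ⟨τ, hτ, w, hw, -⟩ := exists_mem_Icc_vectorState_eq θ t u
  rw [hw] at hfin ⊢
  rw [← vectorState_liftVec_congr fun i j =>
    star_mul_eq_of_far hθ hper hτ.1 hτ.2 hfin (hfar i j)]
  exact horizontalDist_liftVec_lt_top (fun j => (hθ j).continuous) v τ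

end TrivialHolonomy

section BlochMatrix

theorem norm_add_le_norm_smul_one_add {𝕜 A : Type*} [NormedField 𝕜] [NormedRing A]
    [NormedAlgebra 𝕜 A] {x : A} {r : 𝕜} (hx : x * x = r ^ 2 • (1 : A)) (hne : r • (1 : A) + x ≠ 0)
    (t : 𝕜) : ‖t + r‖ ≤ ‖t • (1 : A) + x‖ := by
  -- The range of `r + x` consists of eigenvectors of `x` for the eigenvalue `r`.
  have heigen : (t • (1 : A) + x) * (r • (1 : A) + x) = (t + r) • (r • (1 : A) + x) := by
    simp only [add_mul, mul_add, smul_mul_assoc, mul_smul_comm, one_mul, mul_one, hx]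
    module
  refine le_of_mul_le_mul_right ?_ (norm_pos_iff.2 hne)
  rw [← norm_smul, ← heigen]
  exact norm_mul_le _ _

/-- The Hermitian matrix of trace `2T`, of difference of the diagonal entries `2D`, and of upper
off-diagonal entry `β`. -/
def blochMatrix (T D : ℝ) (β : ℂ) : Matrix (Fin 2) (Fin 2) ℂ :=
  !![(T : ℂ) + D, β; star β, (T : ℂ) - D]

theorem isSelfAdjoint_blochMatrix (T D : ℝ) (β : ℂ) : IsSelfAdjoint (blochMatrix T D β) := by
  ext i j
  fin_cases i <;> fin_cases j <;> simp [blochMatrix, Matrix.star_apply]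

theorem exists_eq_blochMatrix {M : Matrix (Fin 2) (Fin 2) ℂ} (hM : IsSelfAdjoint M) :
    ∃ T D β, M = blochMatrix T D β := by
  have hdiag (i : Fin 2) : ((M i i).re : ℂ) = M i i :=
    Complex.conj_eq_iff_re.1 (congrFun₂ hM i i)
  refine ⟨((M 0 0).re + (M 1 1).re) / 2, ((M 0 0).re - (M 1 1).re) / 2, M 0 1, ?_⟩
  ext i j
  fin_cases i <;> fin_cases j
  · simpa [blochMatrix, hdiag] using by ring
  · simp [blochMatrix]
  · exact (congrFun₂ hM 1 0).symm
  · simpa [blochMatrix, hdiag] using by ring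

theorem blochMatrix_sub (T D T' D' : ℝ) (β β' : ℂ) :
    blochMatrix T D β - blochMatrix T' D' β' = blochMatrix (T - T') (D - D') (β - β') := by
  ext i j
  fin_cases i <;> fin_cases j <;> simp [blochMatrix] <;> ring

theorem blochMatrix_eq_add (T D : ℝ) (β : ℂ) :
    blochMatrix T D β = (T : ℂ) • (1 : Matrix (Fin 2) (Fin 2) ℂ) + blochMatrix 0 D β := by
  ext i j
  fin_cases i <;> fin_cases j <;> simp [blochMatrix, sub_eq_add_neg]

theorem blochMatrix_zero_mul_self (D : ℝ) (β : ℂ) :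
    blochMatrix 0 D β * blochMatrix 0 D β =
      ((D ^ 2 + ‖β‖ ^ 2 : ℝ) : ℂ) • (1 : Matrix (Fin 2) (Fin 2) ℂ) := by
  have hβ : β * star β = (‖β‖ : ℂ) ^ 2 := Complex.mul_conj' β
  rw [blochMatrix, Matrix.mul_fin_two, Matrix.one_fin_two, Matrix.smul_of]
  push_cast
  congr 1
  simp only [Matrix.smul_cons, smul_eq_mul, Matrix.smul_empty, ← hβ]
  ring_nf

theorem norm_blochMatrix_zero (D : ℝ) (β : ℂ) : ‖blochMatrix 0 D β‖ = √(D ^ 2 + ‖β‖ ^ 2) := by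
  rw [eq_comm, Real.sqrt_eq_iff_mul_self_eq (by positivity) (norm_nonneg _), ← sq,
    ← (isSelfAdjoint_blochMatrix 0 D β).norm_mul_self, blochMatrix_zero_mul_self, norm_smul,
    norm_one, mul_one, Complex.norm_of_nonneg (by positivity)]

theorem norm_blochMatrix (T D : ℝ) (β : ℂ) :
    ‖blochMatrix T D β‖ = |T| + √(D ^ 2 + ‖β‖ ^ 2) := by
  have hscalar : ‖(T : ℂ) • (1 : Matrix (Fin 2) (Fin 2) ℂ)‖ = |T| := by
    rw [norm_smul, norm_one, mul_one, Complex.norm_real, Real.norm_eq_abs]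
  rw [blochMatrix_eq_add, ← norm_blochMatrix_zero]
  refine le_antisymm ((norm_add_le _ _).trans_eq (by rw [hscalar])) ?_
  rcases eq_or_ne (blochMatrix 0 D β) 0 with hzero | hzero
  · rw [hzero, norm_zero, add_zero, add_zero, hscalar]
  set ρ := ‖blochMatrix 0 D β‖ with hρ
  obtain ⟨r, hr, hTr⟩ : ∃ r : ℝ, r ^ 2 = ρ ^ 2 ∧ |T + r| = |T| + ρ := by
    rcases le_total 0 T with hT | hT
    · exact ⟨ρ, rfl, by rw [abs_of_nonneg hT, abs_of_nonneg (add_nonneg hT (norm_nonneg _))]⟩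
    · refine ⟨-ρ, neg_sq ρ, ?_⟩
      rw [abs_of_nonpos hT, abs_of_nonpos (by linarith [norm_nonneg (blochMatrix 0 D β)])]
      ring
  have hsq : blochMatrix 0 D β * blochMatrix 0 D β = (r : ℂ) ^ 2 • 1 := by
    rw [blochMatrix_zero_mul_self, ← Complex.ofReal_pow, hr, hρ, norm_blochMatrix_zero,
      Real.sq_sqrt (by positivity)]
  have hne : (r : ℂ) • 1 + blochMatrix 0 D β ≠ 0 := fun h => by
    have hr0 : (r : ℂ) = 0 := by
      simpa [blochMatrix, Matrix.trace_fin_two] using congrArg Matrix.trace h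
    rw [hr0, zero_smul, zero_add] at h
    exact hzero h
  rw [← hTr, ← Real.norm_eq_abs, ← Complex.norm_real, Complex.ofReal_add]
  exact norm_add_le_norm_smul_one_add hsq hne T

theorem norm_blochMatrix_le_iff {T D c : ℝ} {β : ℂ} :
    ‖blochMatrix T D β‖ ≤ c ↔ |T| + |D| ≤ c ∧ ‖β‖ ≤ √((c - |T|) ^ 2 - D ^ 2) := by
  rw [norm_blochMatrix, ← le_sub_iff_add_le', ← le_sub_iff_add_le']
  rcases lt_or_ge (c - |T|) 0 with hneg | hnonneg
  · exact iff_of_false (hneg.trans_le (Real.sqrt_nonneg _)).not_ge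
      fun h => (hneg.trans_le (abs_nonneg D)).not_ge h.1
  · rw [Real.sqrt_le_left hnonneg, ← sq_le_sq₀ (abs_nonneg D) hnonneg, sq_abs]
    refine ⟨fun h => ⟨by nlinarith [sq_nonneg ‖β‖], Real.le_sqrt_of_sq_le (by linarith)⟩,
      fun h => ?_⟩
    linarith [(Real.le_sqrt (norm_nonneg β) (sub_nonneg.2 h.1)).1 h.2]

theorem phaseConj_blochMatrix (x : Fin 2 → ℝ) (T D : ℝ) (β : ℂ) :
    phaseConj x (blochMatrix T D β) = blochMatrix T D (Circle.exp (x 0 - x 1) * β) := by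
  ext i j
  rw [phaseConj_apply]
  fin_cases i <;> fin_cases j
  · simp [blochMatrix]
  · simp [blochMatrix]
  · change Circle.exp (x 1 - x 0) * star β = star (Circle.exp (x 0 - x 1) * β)
    rw [← neg_sub, Circle.exp_neg, Circle.coe_inv_eq_conj, star_mul', starRingEnd_apply]
  · simp [blochMatrix]

theorem expectation_blochMatrix (v : Fin 2 → ℂ) (T D : ℝ) (β : ℂ) :
    expectation v (blochMatrix T D β) =
      ((T * (‖v 0‖ ^ 2 + ‖v 1‖ ^ 2) + altitude v * D + 2 * (star (v 0) * v 1 * β).re : ℝ) : ℂ) := by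
  have h0 : star (v 0) * v 0 = (‖v 0‖ : ℂ) ^ 2 := Complex.conj_mul' _
  have h1 : star (v 1) * v 1 = (‖v 1‖ : ℂ) ^ 2 := Complex.conj_mul' _
  have hre := Complex.add_conj (star (v 0) * v 1 * β)
  rw [map_mul, map_mul, starRingEnd_apply, starRingEnd_apply, star_star, starRingEnd_apply] at hre
  simp only [expectation_eq_sum, Fin.sum_univ_two, blochMatrix, altitude, Matrix.of_apply,
    Matrix.cons_val', Matrix.cons_val_zero, Matrix.cons_val_one, Matrix.cons_val_fin_one]
  push_cast at hre ⊢
  linear_combination (T + D) * h0 + (T - D) * h1 + hre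

end BlochMatrix

section TwoPhases

variable {θ : Fin 2 → ℝ → ℝ} {V : Fin 2 → ℂ}

/-- The off-diagonal entry `⟨V₁, V₂⟩` of the density matrix of the state `V`: together with
`‖V₁‖` and `‖V₂‖` it determines this state. -/
def coherence (V : Fin 2 → ℂ) : ℂ := star (V 0) * V 1

theorem star_mul_eq_of_coherence_eq {v w : Fin 2 → ℂ} (hnorm : ∀ j, ‖v j‖ = ‖w j‖)
    (hcoh : coherence v = coherence w) : ∀ i j, star (v i) * v j = star (w i) * w j := by
  have hsq (j : Fin 2) : star (v j) * v j = star (w j) * w j := by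
    simp only [Complex.star_def, Complex.conj_mul', hnorm j]
  have hcoh' : star (v 1) * v 0 = star (w 1) * w 0 := by
    simpa [coherence, mul_comm] using congrArg star hcoh
  exact Fin.forall_fin_two.2
    ⟨Fin.forall_fin_two.2 ⟨hsq 0, hcoh⟩, Fin.forall_fin_two.2 ⟨hcoh', hsq 1⟩⟩

theorem coherence_rotate (φ : ℝ) (V : Fin 2 → ℂ) :
    coherence (rotate φ V) = Circle.exp φ * coherence V := by
  simp [coherence, rotate, mul_left_comm, mul_comm Complex.I]

theorem norm_rotate (φ : ℝ) (V : Fin 2 → ℂ) (j : Fin 2) : ‖rotate φ V j‖ = ‖V j‖ := by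
  fin_cases j <;> simp [rotate, mul_comm Complex.I]

theorem coherence_liftVec (θ : Fin 2 → ℝ → ℝ) (V : Fin 2 → ℂ) (t : ℝ) :
    coherence (liftVec θ V t) = Circle.exp (Theta θ 0 t - Theta θ 1 t) * coherence V := by
  rw [sub_eq_add_neg, Circle.exp_add, Circle.coe_mul, ← neg_neg (Theta θ 0 t), Circle.exp_neg,
    Circle.coe_inv_eq_conj, coherence, liftVec_apply, liftVec_apply, star_mul', coherence,
    starRingEnd_apply]
  ring

theorem norm_liftVec (θ : Fin 2 → ℝ → ℝ) (V : Fin 2 → ℂ) (t : ℝ) (j : Fin 2) :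
    ‖liftVec θ V t j‖ = ‖V j‖ := by
  rw [liftVec_apply, norm_mul, Circle.norm_coe, one_mul]

theorem sum_norm_sq_eq_one_iff : star V ⬝ᵥ V = 1 ↔ ‖V 0‖ ^ 2 + ‖V 1‖ ^ 2 = 1 := by
  rw [← norm_toLp_sq, EuclideanSpace.norm_sq_eq, Fin.sum_univ_two]
  exact Complex.ofReal_eq_one

theorem radius_eq (hV : star V ⬝ᵥ V = 1) : radius V = 2 * ‖coherence V‖ := by
  have h := sum_norm_sq_eq_one_iff.1 hV
  have hsq : 1 - altitude V ^ 2 = (2 * ‖coherence V‖) ^ 2 := by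
    rw [altitude, coherence, norm_mul, norm_star]
    linear_combination (-‖V 0‖ ^ 2 - ‖V 1‖ ^ 2 - 1) * h
  rw [radius, hsq, Real.sqrt_sq (by positivity)]

theorem exists_eq_circleExp_mul {a b : ℂ} (h : ‖a‖ = ‖b‖) : ∃ φ : ℝ, a = Circle.exp φ * b := by
  refine ⟨a.arg - b.arg, ?_⟩
  calc a = ‖a‖ * Complex.exp (a.arg * Complex.I) := (Complex.norm_mul_exp_arg_mul_I a).symm
    _ = Circle.exp (a.arg - b.arg) * (‖b‖ * Complex.exp (b.arg * Complex.I)) := by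
      rw [h, ← Circle.coe_exp, ← Circle.coe_exp, mul_left_comm, ← Circle.coe_mul,
        ← Circle.exp_add, sub_add_cancel]
    _ = Circle.exp (a.arg - b.arg) * b := by rw [Complex.norm_mul_exp_arg_mul_I]

theorem exists_coherence_eq_rotate {u : Fin 2 → ℂ} (h : ∀ j, ‖u j‖ = ‖V j‖) :
    ∃ φ, coherence u = coherence (rotate φ V) := by
  simp only [coherence_rotate]
  exact exists_eq_circleExp_mul (by simp only [coherence, norm_mul, norm_star, h])

theorem two_pi_mul_omega (θ : Fin 2 → ℝ → ℝ) :
    2 * Real.pi * omega θ = holonomy θ 0 - holonomy θ 1 :=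
  mul_div_cancel₀ _ Real.two_pi_pos.ne'

theorem torusState_eq (hθ : ∀ j, Continuous (θ j))
    (hper : ∀ j, Function.Periodic (θ j) (2 * Real.pi)) (V : Fin 2 → ℂ) (k : ℤ) (τ₀ φ : ℝ) :
    torusState θ V k τ₀ φ =
      vectorState τ₀ (liftVec θ (rotate (φ + k * (2 * Real.pi * omega θ)) V) τ₀) := by
  have harg : 2 * k * Real.pi + τ₀ = τ₀ + k * (2 * Real.pi) := by ring
  rw [torusState, harg, show vectorState (τ₀ + k * (2 * Real.pi)) _ = vectorState τ₀ _ from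
    (periodic_vectorState _).int_mul k τ₀]
  refine vectorState_congr (star_mul_eq_of_coherence_eq
    (fun j => by simp only [norm_rotate, norm_liftVec]) ?_) τ₀
  rw [coherence_rotate, coherence_liftVec, coherence_liftVec, coherence_rotate,
    Theta_add_int_mul_two_pi hθ hper, Theta_add_int_mul_two_pi hθ hper, two_pi_mul_omega,
    ← mul_assoc, ← mul_assoc, ← Circle.coe_mul, ← Circle.coe_mul, ← Circle.exp_add,
    ← Circle.exp_add]
  ring_nf

theorem exists_torusState_eq (hθ : ∀ j, Continuous (θ j))
    (hper : ∀ j, Function.Periodic (θ j) (2 * Real.pi)) {u : Fin 2 → ℂ}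
    (h : ∀ j, ‖u j‖ = ‖V j‖) (t : ℝ) :
    ∃ τ ∈ Set.Icc 0 (2 * Real.pi), ∃ φ, vectorState t u = torusState θ V 0 τ φ := by
  obtain ⟨τ, hτ, w, hw, hnorm⟩ := exists_mem_Icc_vectorState_eq θ t u
  obtain ⟨φ, hφ⟩ := exists_coherence_eq_rotate fun j => (hnorm j).trans (h j)
  refine ⟨τ, hτ, φ, ?_⟩
  rw [hw, torusState_eq hθ hper, Int.cast_zero, zero_mul, add_zero]
  exact vectorState_liftVec_congr (star_mul_eq_of_coherence_eq
    (fun j => by rw [norm_rotate, hnorm, h]) hφ) τ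

theorem mem_torus_of_norm_eq {u : Fin 2 → ℂ} (h : ∀ j, ‖u j‖ = ‖V j‖) (t : ℝ) :
    vectorState t u ∈ torus V := by
  obtain ⟨φ, hφ⟩ := exists_coherence_eq_rotate h
  exact ⟨t, φ, vectorState_congr
    (star_mul_eq_of_coherence_eq (fun j => by rw [norm_rotate, h]) hφ) t⟩

theorem torus_subset_pureStates (hV : star V ⬝ᵥ V = 1) : torus V ⊆ pureStates 2 := by
  rintro _ ⟨t, φ, rfl⟩
  refine ⟨t, _, sum_norm_sq_eq_one_iff.2 ?_, rfl⟩
  rw [norm_rotate, norm_rotate]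
  exact sum_norm_sq_eq_one_iff.1 hV

end TwoPhases

section TwoPhasesTrivialHolonomy

variable {θ : Fin 2 → ℝ → ℝ} {V : Fin 2 → ℂ} {τ₀ φ : ℝ}

theorem forall_far_of_far_zero_one (hfar : Far θ 0 1) : ∀ i j, Far θ i j := by
  have hfar' : Far θ 1 0 := by
    rw [far_iff, ← neg_sub, Circle.exp_neg, far_iff.1 hfar, inv_one]
  exact Fin.forall_fin_two.2 ⟨Fin.forall_fin_two.2 ⟨far_refl θ 0, hfar⟩,
    Fin.forall_fin_two.2 ⟨hfar', far_refl θ 1⟩⟩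

theorem torusState_eq_of_far (hθ : ∀ j, Continuous (θ j))
    (hper : ∀ j, Function.Periodic (θ j) (2 * Real.pi)) (hfar : Far θ 0 1) (V : Fin 2 → ℂ) (k : ℤ)
    (τ₀ φ : ℝ) : torusState θ V k τ₀ φ = vectorState τ₀ (liftVec θ (rotate φ V) τ₀) := by
  have hk : Circle.exp (k * (2 * Real.pi * omega θ)) = 1 := by
    rw [← zsmul_eq_mul, Circle.exp_zsmul, two_pi_mul_omega, far_iff.1 hfar, one_zpow]
  rw [torusState_eq hθ hper]
  refine vectorState_liftVec_congr (star_mul_eq_of_coherence_eq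
    (fun j => by rw [norm_rotate, norm_rotate]) ?_) τ₀
  rw [coherence_rotate, coherence_rotate, Circle.exp_add, hk, mul_one]

theorem coherence_rotate_eq_self_iff (hV : star V ⬝ᵥ V = 1) :
    coherence (rotate φ V) = coherence V ↔ (∃ m : ℤ, φ = 2 * Real.pi * m) ∨ radius V = 0 := by
  rw [coherence_rotate, mul_left_eq_self₀, radius_eq hV, Circle.coe_eq_one, Circle.exp_eq_one]
  simp [mul_comm]

theorem spectralDist_torusState_of_coherence_rotate_eq (hθ : ∀ j, ContDiff ℝ ∞ (θ j))
    (hper : ∀ j, Function.Periodic (θ j) (2 * Real.pi)) (hfar : Far θ 0 1) (hV : star V ⬝ᵥ V = 1)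
    (h0 : 0 ≤ τ₀) (h1 : τ₀ ≤ 2 * Real.pi) (hφ : coherence (rotate φ V) = coherence V) (k : ℤ) :
    spectralDist θ (vectorState 0 V) (torusState θ V k τ₀ φ) =
      ENNReal.ofReal (min τ₀ (2 * Real.pi - τ₀)) := by
  rw [torusState_eq_of_far (fun j => (hθ j).continuous) hper hfar,
    vectorState_liftVec_congr (star_mul_eq_of_coherence_eq (norm_rotate φ V) hφ)]
  exact spectralDist_liftVec_of_forall_far hθ hper (forall_far_of_far_zero_one hfar) h0 h1 hV

theorem spectralDist_torusState_of_coherence_rotate_ne (hθ : ∀ j, ContDiff ℝ ∞ (θ j))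
    (hper : ∀ j, Function.Periodic (θ j) (2 * Real.pi)) (hfar : Far θ 0 1) (h0 : 0 ≤ τ₀)
    (h1 : τ₀ ≤ 2 * Real.pi) (hφ : coherence (rotate φ V) ≠ coherence V) (k : ℤ) :
    spectralDist θ (vectorState 0 V) (torusState θ V k τ₀ φ) = ⊤ := by
  rw [torusState_eq_of_far (fun j => (hθ j).continuous) hper hfar]
  by_contra hfin
  exact hφ (star_mul_eq_of_far hθ hper h0 h1 (lt_top_iff_ne_top.2 hfin) hfar).symm

end TwoPhasesTrivialHolonomy

section Triangle

variable {θ : Fin 2 → ℝ → ℝ} {s τ₀ : ℝ}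

theorem abs_eq_mul_of_nonneg (hs : s = 1 ∨ s = -1) {r : ℝ} (h : 0 ≤ s * r) : |r| = s * r := by
  rw [← abs_of_nonneg h, abs_mul, (abs_eq zero_le_one).2 hs, one_mul]

theorem isCompact_triangle (hs : s = 1 ∨ s = -1) (τ₀ : ℝ) : IsCompact (triangle s τ₀) := by
  refine Metric.isCompact_of_isClosed_isBounded ?_ ?_
  · exact (isClosed_le continuous_const continuous_fst).inter
      ((isClosed_le continuous_const (by fun_prop : Continuous fun x : ℝ × ℝ => s * x.2)).inter
        (isClosed_le (by fun_prop : Continuous fun x : ℝ × ℝ => x.1 + s * x.2) continuous_const))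
  · refine Metric.isBounded_closedBall (x := 0) (r := τ₀) |>.subset fun x ⟨hT, hD, hTD⟩ => ?_
    have hmin := min_le_left τ₀ (2 * Real.pi - τ₀)
    rw [mem_closedBall_zero_iff, Prod.norm_def, Real.norm_eq_abs, Real.norm_eq_abs,
      abs_of_nonneg hT, abs_eq_mul_of_nonneg hs hD]
    exact max_le (by linarith) (by linarith)

theorem triangle_nonempty (s : ℝ) (h0 : 0 ≤ τ₀) (h1 : τ₀ ≤ 2 * Real.pi) :
    (triangle s τ₀).Nonempty :=
  ⟨(0, 0), by simp [triangle, h0, h1]⟩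

theorem continuous_H (θ : Fin 2 → ℝ → ℝ) (V : Fin 2 → ℂ) (k : ℤ) (τ₀ φ : ℝ) :
    Continuous (H θ V k τ₀ φ) := by
  unfold H
  fun_prop

end Triangle

section TwoPhasesNontrivialHolonomy

variable {θ : Fin 2 → ℝ → ℝ} {V : Fin 2 → ℂ} {s τ₀ φ : ℝ}

/-- The coefficient `(e^{iψ} - 1) / (e^{2πiω} - 1)`, whose modulus is `W_k` for
`ψ = φ + 2kπω`. -/
def twistCoeff (θ : Fin 2 → ℝ → ℝ) (ψ : ℝ) : ℂ :=
  (Circle.exp ψ - 1) / (Circle.exp (2 * Real.pi * omega θ) - 1)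

theorem norm_circleExp_sub_one (x : ℝ) : ‖(Circle.exp x : ℂ) - 1‖ = 2 * |Real.sin (x / 2)| := by
  rw [Circle.coe_exp, mul_comm, Complex.norm_exp_I_mul_ofReal_sub_one, norm_mul, Real.norm_two,
    Real.norm_eq_abs]

theorem norm_twistCoeff (θ : Fin 2 → ℝ → ℝ) (φ : ℝ) (k : ℤ) :
    ‖twistCoeff θ (φ + k * (2 * Real.pi * omega θ))‖ = W θ φ k := by
  rw [twistCoeff, norm_div, norm_circleExp_sub_one, norm_circleExp_sub_one,
    mul_div_mul_left _ _ two_ne_zero, W]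
  congr 3 <;> ring_nf

theorem circleExp_two_pi_omega_sub_one_ne_zero (hfar : ¬Far θ 0 1) :
    (Circle.exp (2 * Real.pi * omega θ) : ℂ) - 1 ≠ 0 := by
  rwa [sub_ne_zero, Ne, Circle.coe_eq_one, two_pi_mul_omega, ← far_iff]

theorem circleExp_mul_sub_eq_twistCoeff (hfar : ¬Far θ 0 1) (ψ : ℝ) (β₀ β₁ : ℂ) :
    Circle.exp ψ * β₁ - β₀ = twistCoeff θ (ψ + 2 * Real.pi * omega θ) * (β₁ - β₀) +
      twistCoeff θ ψ * (Circle.exp (2 * Real.pi * omega θ) * β₀ - β₁) := by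
  have hne := circleExp_two_pi_omega_sub_one_ne_zero hfar
  rw [twistCoeff, twistCoeff, Circle.exp_add, Circle.coe_mul]
  field_simp
  ring

theorem expectation_rotate_sub_expectation (hfar : ¬Far θ 0 1) (hV : star V ⬝ᵥ V = 1)
    (ψ T₀ D₀ T₁ D₁ : ℝ) (β₀ β₁ : ℂ) :
    expectation (rotate ψ V) (blochMatrix T₁ D₁ β₁) - expectation V (blochMatrix T₀ D₀ β₀) =
      (((T₁ - T₀) + altitude V * (D₁ - D₀) +
        2 * (coherence V * twistCoeff θ (ψ + 2 * Real.pi * omega θ) * (β₁ - β₀)).re +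
        2 * (coherence V * twistCoeff θ ψ *
          (Circle.exp (2 * Real.pi * omega θ) * β₀ - β₁)).re : ℝ) : ℂ) := by
  have hunit := sum_norm_sq_eq_one_iff.1 hV
  have halt : altitude (rotate ψ V) = altitude V := by
    rw [altitude, norm_rotate, norm_rotate, altitude]
  have hcoh : star (rotate ψ V 0) * rotate ψ V 1 = coherence V * Circle.exp ψ :=
    (coherence_rotate ψ V).trans (mul_comm _ _)
  have hsplit := congrArg (fun β => (coherence V * β).re)
    (circleExp_mul_sub_eq_twistCoeff hfar ψ β₀ β₁)
  rw [expectation_blochMatrix, expectation_blochMatrix, halt, hcoh, ← coherence, norm_rotate,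
    norm_rotate, hunit, ← Complex.ofReal_sub, Complex.ofReal_inj]
  simp only [mul_add, mul_sub, ← mul_assoc, Complex.add_re, Complex.sub_re] at hsplit ⊢
  linear_combination 2 * hsplit

theorem blochMatrix_mem_observablePairs_iff {x : Fin 2 → ℝ} {τ T₀ D₀ T₁ D₁ : ℝ} {β₀ β₁ : ℂ} :
    (blochMatrix T₀ D₀ β₀, blochMatrix T₁ D₁ β₁) ∈ observablePairs x τ ↔
      |T₁ - T₀| + |D₁ - D₀| ≤ min τ (2 * Real.pi - τ) ∧
        ‖β₁ - β₀‖ ≤ √((τ - |T₁ - T₀|) ^ 2 - (D₁ - D₀) ^ 2) ∧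
        ‖Circle.exp (x 0 - x 1) * β₀ - β₁‖ ≤
          √((2 * Real.pi - τ - |T₁ - T₀|) ^ 2 - (D₁ - D₀) ^ 2) := by
  simp only [observablePairs, Set.mem_ofPred_eq, isSelfAdjoint_blochMatrix, true_and,
    phaseConj_blochMatrix, blochMatrix_sub, norm_blochMatrix_le_iff, le_min_iff,
    abs_sub_comm T₀, abs_sub_comm D₀, sub_sq_comm D₀]
  tauto

theorem H_eq (hV : star V ⬝ᵥ V = 1) (k : ℤ) (τ₀ φ : ℝ) (x : ℝ × ℝ) :
    H θ V k τ₀ φ x = x.1 + altitude V * x.2 +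
      2 * (‖coherence V * twistCoeff θ (φ + k * (2 * Real.pi * omega θ) + 2 * Real.pi * omega θ)‖ *
        √((τ₀ - x.1) ^ 2 - x.2 ^ 2)) +
      2 * (‖coherence V * twistCoeff θ (φ + k * (2 * Real.pi * omega θ))‖ *
        √((2 * Real.pi - τ₀ - x.1) ^ 2 - x.2 ^ 2)) := by
  have hsucc := norm_twistCoeff θ φ (k + 1)
  rw [Int.cast_add, Int.cast_one, add_one_mul, ← add_assoc] at hsucc
  rw [H, norm_mul, norm_mul, hsucc, norm_twistCoeff, radius_eq hV]
  ring

theorem abs_add_re_le_H (hV : star V ⬝ᵥ V = 1) (hs : s = 1 ∨ s = -1) (hz : 0 ≤ s * altitude V)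
    (k : ℤ) {T D : ℝ} {g g' : ℂ} (hg : ‖g‖ ≤ √((τ₀ - |T|) ^ 2 - D ^ 2))
    (hg' : ‖g'‖ ≤ √((2 * Real.pi - τ₀ - |T|) ^ 2 - D ^ 2)) :
    |T + altitude V * D +
      2 * (coherence V *
        twistCoeff θ (φ + k * (2 * Real.pi * omega θ) + 2 * Real.pi * omega θ) * g).re +
      2 * (coherence V * twistCoeff θ (φ + k * (2 * Real.pi * omega θ)) * g').re| ≤
      H θ V k τ₀ φ (|T|, s * |D|) := by
  have hsq : (s * |D|) ^ 2 = D ^ 2 := by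
    rw [mul_pow, sq_abs, sq, mul_self_eq_one_iff.2 hs, one_mul]
  have halt : |altitude V * D| = altitude V * (s * |D|) := by
    rw [abs_mul, abs_eq_mul_of_nonneg hs hz]
    ring
  have hre {c w : ℂ} {r : ℝ} (hw : ‖w‖ ≤ r) : |2 * (c * w).re| ≤ 2 * (‖c‖ * r) := by
    rw [abs_mul, abs_two]
    gcongr
    calc |(c * w).re| ≤ ‖c * w‖ := Complex.abs_re_le_norm _
      _ ≤ ‖c‖ * r := by rw [norm_mul]; gcongr
  rw [H_eq hV, hsq, ← halt]
  exact (abs_add_le _ _).trans (add_le_add ((abs_add_le _ _).trans (add_le_add (abs_add_le _ _)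
    (hre hg))) (hre hg'))

theorem exists_mem_triangle_norm_expectation_sub_le (hfar : ¬Far θ 0 1) (hV : star V ⬝ᵥ V = 1)
    (hs : s = 1 ∨ s = -1) (hz : 0 ≤ s * altitude V) (k : ℤ) (φ : ℝ)
    {B : Matrix (Fin 2) (Fin 2) ℂ × Matrix (Fin 2) (Fin 2) ℂ}
    (hB : B ∈ observablePairs (holonomy θ) τ₀) :
    ∃ x ∈ triangle s τ₀,
      ‖expectation V B.1 - expectation (rotate (φ + k * (2 * Real.pi * omega θ)) V) B.2‖ ≤
        H θ V k τ₀ φ x := by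
  obtain ⟨B₀, B₁⟩ := B
  obtain ⟨T₀, D₀, β₀, rfl⟩ := exists_eq_blochMatrix hB.1
  obtain ⟨T₁, D₁, β₁, rfl⟩ := exists_eq_blochMatrix hB.2.1
  obtain ⟨hTD, hg, hg'⟩ := blochMatrix_mem_observablePairs_iff.1 hB
  rw [← two_pi_mul_omega] at hg'
  refine ⟨(|T₁ - T₀|, s * |D₁ - D₀|), ?_, ?_⟩
  · have hss : s * (s * |D₁ - D₀|) = |D₁ - D₀| := by
      rw [← mul_assoc, mul_self_eq_one_iff.2 hs, one_mul]
    simp only [triangle, Set.mem_ofPred_eq, hss]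
    exact ⟨abs_nonneg _, abs_nonneg _, hTD⟩
  · rw [norm_sub_rev, expectation_rotate_sub_expectation hfar hV, Complex.norm_real,
      Real.norm_eq_abs]
    exact abs_add_re_le_H hV hs hz k hg hg'

theorem exists_norm_eq_mul_eq (c : ℂ) {r : ℝ} (hr : 0 ≤ r) :
    ∃ w : ℂ, ‖w‖ = r ∧ c * w = (‖c‖ * r : ℝ) := by
  obtain ⟨u, hu, hcu⟩ := RCLike.exists_norm_eq_mul_self c
  refine ⟨u * r, by rw [norm_mul, hu, one_mul, Complex.norm_of_nonneg hr], ?_⟩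
  rw [Complex.ofReal_mul, ← RCLike.ofReal_eq_complex_ofReal, hcu]
  ring

theorem exists_mem_observablePairs_H_eq (hfar : ¬Far θ 0 1) (hV : star V ⬝ᵥ V = 1)
    (hs : s = 1 ∨ s = -1) (k : ℤ) (φ : ℝ) {x : ℝ × ℝ} (hx : x ∈ triangle s τ₀) :
    ∃ B ∈ observablePairs (holonomy θ) τ₀,
      expectation (rotate (φ + k * (2 * Real.pi * omega θ)) V) B.2 - expectation V B.1 =
        (H θ V k τ₀ φ x : ℂ) := by
  obtain ⟨T, D⟩ := x
  obtain ⟨hT, hD, hTD⟩ := hx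
  set ψ := φ + k * (2 * Real.pi * omega θ) with hψ
  obtain ⟨g, hg, hgre⟩ := exists_norm_eq_mul_eq
    (coherence V * twistCoeff θ (ψ + 2 * Real.pi * omega θ))
    (Real.sqrt_nonneg ((τ₀ - T) ^ 2 - D ^ 2))
  obtain ⟨g', hg', hgre'⟩ := exists_norm_eq_mul_eq (coherence V * twistCoeff θ ψ)
    (Real.sqrt_nonneg ((2 * Real.pi - τ₀ - T) ^ 2 - D ^ 2))
  set η := (Circle.exp (2 * Real.pi * omega θ) : ℂ) with hη
  obtain ⟨β, hβ⟩ : ∃ β, η * β - (β + g) = g' := by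
    refine ⟨(g + g') / (η - 1), ?_⟩
    have hη1 : η - 1 ≠ 0 := circleExp_two_pi_omega_sub_one_ne_zero hfar
    field_simp
    ring
  refine ⟨(blochMatrix 0 0 β, blochMatrix T D (β + g)), ?_, ?_⟩
  · rw [blochMatrix_mem_observablePairs_iff, ← two_pi_mul_omega, ← hη, hβ]
    simp only [sub_zero, add_sub_cancel_left, abs_of_nonneg hT, abs_eq_mul_of_nonneg hs hD]
    exact ⟨hTD, hg.le, hg'.le⟩
  · rw [expectation_rotate_sub_expectation hfar hV, ← hη, hβ, add_sub_cancel_left, hgre, hgre',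
      H_eq hV, ← hψ]
    simp only [Complex.ofReal_re, sub_zero]

theorem exists_isGreatest_H_and_spectralDist_torusState_eq (hθ : ∀ j, ContDiff ℝ ∞ (θ j))
    (hper : ∀ j, Function.Periodic (θ j) (2 * Real.pi)) (hfar : ¬Far θ 0 1) (hV : star V ⬝ᵥ V = 1)
    (hs : s = 1 ∨ s = -1) (hz : 0 ≤ s * altitude V) (h0 : 0 ≤ τ₀) (h1 : τ₀ ≤ 2 * Real.pi) (k : ℤ)
    (φ : ℝ) :
    ∃ M : ℝ, IsGreatest (H θ V k τ₀ φ '' triangle s τ₀) M ∧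
      spectralDist θ (vectorState 0 V) (torusState θ V k τ₀ φ) = ENNReal.ofReal M := by
  obtain ⟨M, hM⟩ := ((isCompact_triangle hs τ₀).image (continuous_H θ V k τ₀ φ)).exists_isGreatest
    ((triangle_nonempty s h0 h1).image _)
  refine ⟨M, hM, ?_⟩
  rw [torusState_eq (fun j => (hθ j).continuous) hper, spectralDist_liftVec_eq_iSup hθ hper h0 h1]
  refine le_antisymm (iSup₂_le fun B hB => ENNReal.ofReal_le_ofReal ?_) ?_
  · obtain ⟨x, hx, hle⟩ := exists_mem_triangle_norm_expectation_sub_le hfar hV hs hz k φ hB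
    exact hle.trans (hM.2 ⟨x, hx, rfl⟩)
  · obtain ⟨x, hx, rfl⟩ := hM.1
    obtain ⟨B, hB, hval⟩ := exists_mem_observablePairs_H_eq hfar hV hs k φ hx
    refine le_iSup₂_of_le B hB (ENNReal.ofReal_le_ofReal ?_)
    rw [norm_sub_rev, hval, Complex.norm_real]
    exact le_abs_self _

theorem exists_sign_mul_nonneg (r : ℝ) : ∃ s : ℝ, (s = 1 ∨ s = -1) ∧ 0 ≤ s * r :=
  (le_total 0 r).elim (fun h => ⟨1, .inl rfl, by simpa⟩) fun h => ⟨-1, .inr rfl, by simpa⟩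

theorem Con_eq_torus (hθ : ∀ j, ContDiff ℝ ∞ (θ j))
    (hper : ∀ j, Function.Periodic (θ j) (2 * Real.pi)) (hfar : ¬Far θ 0 1)
    (hV : star V ⬝ᵥ V = 1) : Con θ (vectorState 0 V) = torus V := by
  refine Set.Subset.antisymm ?_ fun q hq => ⟨torus_subset_pureStates hV hq, ?_⟩
  · rintro _ ⟨⟨t, u, -, rfl⟩, hfin⟩
    obtain ⟨τ, hτ, w, hw, hnorm⟩ := exists_mem_Icc_vectorState_eq θ t u
    rw [hw] at hfin
    refine mem_torus_of_norm_eq (fun j => ?_) t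
    have hsq : ((‖V j‖ ^ 2 : ℝ) : ℂ) = (‖w j‖ ^ 2 : ℝ) := by
      simpa [Complex.conj_mul'] using star_mul_eq_of_far hθ hper hτ.1 hτ.2 hfin (far_refl θ j)
    rw [← hnorm, (sq_eq_sq₀ (norm_nonneg _) (norm_nonneg _)).1 (Complex.ofReal_inj.1 hsq)]
  · obtain ⟨t, φ', rfl⟩ := hq
    obtain ⟨τ, hτ, φ, hφ⟩ := exists_torusState_eq (fun j => (hθ j).continuous) hper
      (norm_rotate φ' V) t
    obtain ⟨s, hs, hz⟩ := exists_sign_mul_nonneg (altitude V)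
    obtain ⟨M, -, hM⟩ := exists_isGreatest_H_and_spectralDist_torusState_eq hθ hper hfar hV hs hz
      hτ.1 hτ.2 0 φ
    rw [hφ, hM]
    exact ENNReal.ofReal_lt_top

end TwoPhasesNontrivialHolonomy

end SpectralCircle

end

theorem mainTheorem2 (θ : Fin 2 → ℝ → ℝ) (hθ : ∀ j, ContDiff ℝ ∞ (θ j))
    (hper : ∀ j, Function.Periodic (θ j) (2 * Real.pi))
    (V : Fin 2 → ℂ) (hV : star V ⬝ᵥ V = 1) :
    (SpectralCircle.Far θ 0 1 →
      SpectralCircle.Con θ (SpectralCircle.vectorState 0 V) =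
          SpectralCircle.Acc θ (SpectralCircle.vectorState 0 V) ∧
        ∀ (k : ℤ) (τ₀ φ : ℝ), 0 ≤ τ₀ → τ₀ ≤ 2 * Real.pi →
          (((∃ m : ℤ, φ = 2 * Real.pi * m) ∨ SpectralCircle.radius V = 0) →
            SpectralCircle.spectralDist θ (SpectralCircle.vectorState 0 V)
                (SpectralCircle.torusState θ V k τ₀ φ) =
              ENNReal.ofReal (min τ₀ (2 * Real.pi - τ₀))) ∧
          ((¬ ∃ m : ℤ, φ = 2 * Real.pi * m) → SpectralCircle.radius V ≠ 0 →
            SpectralCircle.spectralDist θ (SpectralCircle.vectorState 0 V)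
                (SpectralCircle.torusState θ V k τ₀ φ) = ⊤)) ∧
    (¬ SpectralCircle.Far θ 0 1 →
      SpectralCircle.Con θ (SpectralCircle.vectorState 0 V) = SpectralCircle.torus V ∧
        ∀ (k : ℤ) (τ₀ φ : ℝ), 0 ≤ τ₀ → τ₀ ≤ 2 * Real.pi →
          ∀ s : ℝ, (s = 1 ∨ s = -1) → 0 ≤ s * SpectralCircle.altitude V →
            ∃ M : ℝ,
              IsGreatest (SpectralCircle.H θ V k τ₀ φ '' SpectralCircle.triangle s τ₀) M ∧
              SpectralCircle.spectralDist θ (SpectralCircle.vectorState 0 V)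
                (SpectralCircle.torusState θ V k τ₀ φ) = ENNReal.ofReal M) := by
  refine ⟨fun hfar => ⟨?_, fun k τ₀ φ h0 h1 => ?_⟩,
    fun hfar => ⟨?_, fun k τ₀ φ h0 h1 s hs hz => ?_⟩⟩
  · exact SpectralCircle.Con_eq_Acc_of_forall_far hθ hper
      (SpectralCircle.forall_far_of_far_zero_one hfar) V
  · have hφ_iff := SpectralCircle.coherence_rotate_eq_self_iff (φ := φ) hV
    exact ⟨fun hφ => SpectralCircle.spectralDist_torusState_of_coherence_rotate_eq hθ hper hfar hV
        h0 h1 (hφ_iff.2 hφ) k,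
      fun hφ hR => SpectralCircle.spectralDist_torusState_of_coherence_rotate_ne hθ hper hfar
        h0 h1 (mt hφ_iff.1 (not_or.2 ⟨hφ, hR⟩)) k⟩
  · exact SpectralCircle.Con_eq_torus hθ hper hfar hV
  · exact SpectralCircle.exists_isGreatest_H_and_spectralDist_torusState_eq hθ hper hfar hV hs hz
      h0 h1 k φ
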